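/- **Setting.** Let $\Omega\subset\mathbb R^3$ be a simply connected bounded domain that is equal to the interior of its closure (no slits). Let $\mathcal T_h$ be a finite conforming partition of $\overline\Omega$ into closed parallelepipeds (in particular, rectangular cuboids) $E=F_E(\hat E)$, where $\hat E=[0,1]^3$ and $F_E(\hat{\mathbf x})=\mathbf r_1+DF_E\,\hat{\mathbf x}$ is affine and bijective; two different elements are disjoint or meet in a common vertex, edge or face. Put $J_E=|\det DF_E|$. Let $\partial\Omega=\Gamma_D\cup\Gamma_N$ with $\Gamma_D\ne\emptyset$, where $\Gamma_D$ and $\Gamma_N$ are unions of element faces lying on $\partial\Omega$, and every such face belongs to exactly one of the two. Write $\mathbb M$ for the real $3\times3$ matrices, $\mathbb N$ for the skew-symmetric ones, $\tau:\chi=\sum_{ij}\tau_{ij}\chi_{ij}$, and $(\cdot,\cdot)$ for the $L^2(\Omega)$ inner product; divergences of matrix fields are taken row by row. Let $A(\mathbf x):\mathbb M\to\mathbb M$, $\mathbf x\in\Omega$, be a linear compliance tensor that maps symmetric matrices to symmetric matrices, is symmetric, bounded and positive definite uniformly in $\mathbf x$, and is element-wise continuous, i.e. its restriction to the interior of each $E$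 extends continuously to $E$. Let $f\in L^2(\Omega,\mathbb R^3)$. **Spaces.** On $\hat E$ let $\mathcal{RT}_0$ be the space of fields $(\alpha_1+\beta_1\hat x,\ \alpha_2+\beta_2\hat y,\ \alpha_3+\beta_3\hat z)^T$ with real $\alpha_i,\beta_i$, and let $\mathcal{ERT}_0(\hat E)=\mathcal{RT}_0+\operatorname{curl}(\hat{\mathbf x}\times\mathcal B)$, where $\mathcal B$ is spanned by the fields $m\,e_k$ ($k=1,2,3$) with $m$ a monomial of degree at most one in each of $\hat x,\hat y,\hat z$ and $m\ne 1$, $m\neq \hat x_k$. Let $\hat{\mathbb X}$ be the space of matrix fields on $\hat E$ all of whose rows lie in $\mathcal{ERT}_0(\hat E)$, and put $$\mathbb X_h=\Big\{\tau\in H(\operatorname{div};\Omega,\mathbb M):\ \tau n=0\text{ on }\Gamma_N,\ \ \tau|_E=\tfrac1{J_E}\,(\hat\tau\circ F_E^{-1})\,DF_E^T\text{ with }\hat\tau\in\hat{\mathbb X}\ \ \forall E\in\mathcal T_h\Big\},$$ where $\tau n=0$ on $\Gamma_N$ is meant in the sense of the normal trace of $H(\operatorname{div})$. Let $V_h\subset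 L^2(\Omega,\mathbb R^3)$ and $\mathbb W_h^0\subset L^2(\Omega,\mathbb N)$ be the spaces of fields that are constant on every $E\in\mathcal T_h$. **Quadrature.** For $\tau,\chi\in\mathbb X_h$, with the corresponding $\hat\tau,\hat\chi$ on each element, let $$(A\tau,\chi)_Q=\sum_{E\in\mathcal T_h}\frac18\sum_{i=1}^8 \hat A_E(\hat{\mathbf r}_i)\Big[\tfrac1{J_E}\hat\tau(\hat{\mathbf r}_i)DF_E^T\Big]:\hat\chi(\hat{\mathbf r}_i)DF_E^T ,$$ where $\hat{\mathbf r}_1,\dots,\hat{\mathbf r}_8$ are the vertices of $\hat E$ and $\hat A_E=A|_E\circ F_E$, with $A|_E$ the continuous extension from the interior of $E$. **Theorem.** The MSMFE-0 method: find $(\sigma_h,u_h,\gamma_h)\in\mathbb X_h\times V_h\times\mathbb W_h^0$ such that $$\begin{aligned} (A\sigma_h,\tau)_Q+(u_h,\operatorname{div}\tau)+(\gamma_h,\tau)&=0 &&\forall\tau\in\mathbb X_h,\\ (\operatorname{div}\sigma_h,v)&=(f,v) &&\forall v\in V_h,\\ (\sigma_h,w)&=0 &&\forall w\in\mathbb W_h^0,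 \end{aligned}$$ has a unique solution (functions being identified when they agree almost everywhere in $\Omega$). -/

import Mathlib

open MeasureTheory Topology
open scoped Matrix ContDiff

namespace MSMFE

/-- Points and vectors of `ℝ³`. -/
abbrev R3 : Type := Fin 3 → ℝ

/-- The space of real `3 × 3` matrices. -/
abbrev Mat : Type := Matrix (Fin 3) (Fin 3) ℝ

/-- The Frobenius product `σ : τ`. -/
def frob (σ τ : Mat) : ℝ := ∑ i, ∑ j, σ i j * τ i j

noncomputable section

/-! ### The continuous spaces -/

/-- `L²(Ω)`, for scalar functions. -/
def IsL2 (Ω : Set R3) (g : R3 → ℝ) : Prop := MemLp g 2 (volume.restrict Ω)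

/-- The partial derivative `∂φ/∂xⱼ`. -/
def partialDeriv (j : Fin 3) (φ : R3 → ℝ) (x : R3) : ℝ := fderiv ℝ φ x (Pi.single j 1)

/-- `g` is a distributional divergence of the vector field `q` on `Ω`. -/
def HasWeakDiv (Ω : Set R3) (q : R3 → R3) (g : R3 → ℝ) : Prop :=
  ∀ φ : R3 → ℝ, ContDiff ℝ ∞ φ → HasCompactSupport φ → tsupport φ ⊆ Ω →
    ∫ x in Ω, ∑ j, q x j * partialDeriv j φ x = - ∫ x in Ω, g x * φ x

/-- `H(div; Ω)`. -/
def IsHDiv (Ω : Set R3) (q : R3 → R3) : Prop :=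
  (∀ j, IsL2 Ω (fun x => q x j)) ∧ ∃ g, IsL2 Ω g ∧ HasWeakDiv Ω q g

open Classical in
/-- The divergence of a field in `H(div; Ω)`, as an `L²` function (unique almost everywhere
when `Ω` is open); zero for other fields. -/
def weakDiv (Ω : Set R3) (q : R3 → R3) : R3 → ℝ :=
  if h : ∃ g, IsL2 Ω g ∧ HasWeakDiv Ω q g then h.choose else 0

/-- `q · n = 0` on `∂Ω ∖ ΓD`, in the sense of the normal trace of `H(div; Ω)`:
`⟨q · n, φ⟩ = ∫ (q · ∇φ + (div q) φ)` vanishes for all smooth `φ` that vanish near `ΓD`. -/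
def HasZeroNormalTraceOff (Ω ΓD : Set R3) (q : R3 → R3) : Prop :=
  ∀ φ : R3 → ℝ, ContDiff ℝ ∞ φ → HasCompactSupport φ → Disjoint (tsupport φ) ΓD →
    ∫ x in Ω, ((∑ j, q x j * partialDeriv j φ x) + weakDiv Ω q x * φ x) = 0

/-- The row-wise divergence of a matrix field. -/
def matDiv (Ω : Set R3) (τ : R3 → Mat) : R3 → R3 :=
  fun x i => weakDiv Ω (fun y => τ y i) x

/-- The stress space `𝕏 = {τ ∈ H(div; Ω, 𝕄) : τ n = 0 on ΓN}`, where `∂Ω = ΓD ∪ ΓN`. -/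
def IsStress (Ω ΓD : Set R3) (τ : R3 → Mat) : Prop :=
  ∀ i, IsHDiv Ω (fun x => τ x i) ∧ HasZeroNormalTraceOff Ω ΓD (fun x => τ x i)

/-- The displacement space `V = L²(Ω, ℝ³)`. -/
def IsDisplacement (Ω : Set R3) (v : R3 → R3) : Prop :=
  ∀ i, IsL2 Ω (fun x => v x i)

/-- The rotation space `𝕎 = L²(Ω, ℕ)` of fields of skew-symmetric matrices. -/
def IsRotation (Ω : Set R3) (w : R3 → Mat) : Prop :=
  (∀ i j, IsL2 Ω (fun x => w x i j)) ∧ ∀ᵐ x ∂volume.restrict Ω, (w x)ᵀ = - w x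

/-! ### The reference cube and the enhanced Raviart-Thomas space -/

/-- The faces of all dimensions of the closed unit cube: coordinate `i` is free when `s i` is
`none`, and it is fixed to `0` or `1` when `s i` is `some false` or `some true`. -/
def refFace (s : Fin 3 → Option Bool) : Set R3 :=
  {x | ∀ i, 0 ≤ x i ∧ x i ≤ 1 ∧ (s i = some false → x i = 0) ∧ (s i = some true → x i = 1)}

/-- The closed unit cube. -/
def refCube : Set R3 := {x | ∀ i, 0 ≤ x i ∧ x i ≤ 1}

/-- The eight vertices of the unit cube. -/
def refVertex (s : Fin 3 → Bool) : R3 := fun i => if s i then 1 else 0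

/-- The lowest order Raviart-Thomas space on the unit cube. -/
def RT0 : Submodule ℝ (R3 → R3) :=
  Submodule.span ℝ {q | ∃ α β : R3, q = fun x i => α i + β i * x i}

/-- `curl (x × ℬ)`, where `ℬ` is spanned by the fields `m eₖ`, with `m` a monomial of degree
at most one in each variable, different from `1` and from `xₖ`. -/
def curlBubble : Submodule ℝ (R3 → R3) :=
  Submodule.span ℝ
    { fun x => ![-3 * x 1, 0, 0],
      fun x => ![-3 * x 2, 0, 0],
      fun x => ![-4 * x 1 * x 2, 0, 0],
      fun x => ![-3 * x 0 * x 1, x 1 ^ 2, x 1 * x 2],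
      fun x => ![-3 * x 0 * x 2, x 1 * x 2, x 2 ^ 2],
      fun x => ![-4 * x 0 * x 1 * x 2, x 1 ^ 2 * x 2, x 1 * x 2 ^ 2],
      fun x => ![0, -3 * x 0, 0],
      fun x => ![0, -3 * x 2, 0],
      fun x => ![0, -4 * x 0 * x 2, 0],
      fun x => ![x 0 ^ 2, -3 * x 0 * x 1, x 0 * x 2],
      fun x => ![x 0 * x 2, -3 * x 1 * x 2, x 2 ^ 2],
      fun x => ![x 0 ^ 2 * x 2, -4 * x 0 * x 1 * x 2, x 0 * x 2 ^ 2],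
      fun x => ![0, 0, -3 * x 0],
      fun x => ![0, 0, -3 * x 1],
      fun x => ![0, 0, -4 * x 0 * x 1],
      fun x => ![x 0 ^ 2, x 0 * x 1, -3 * x 0 * x 2],
      fun x => ![x 0 * x 1, x 1 ^ 2, -3 * x 1 * x 2],
      fun x => ![x 0 ^ 2 * x 1, x 0 * x 1 ^ 2, -4 * x 0 * x 1 * x 2] }

/-- The lowest order enhanced Raviart-Thomas space `ERT₀ = RT₀ + curl (x × ℬ)`. -/
def ERT0 : Submodule ℝ (R3 → R3) := RT0 ⊔ curlBubble

/-- Reference stresses: matrix fields all of whose rows lie in `ERT₀`. -/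
def IsRefStress (τ : R3 → Mat) : Prop := ∀ i, (fun x => τ x i) ∈ ERT0

/-! ### Elements and partitions -/

/-- An element, given by the bijective affine map `F x = r₁ + DF x` from the unit cube; the
columns of `DF` are the three edge vectors at the vertex `r₁`. -/
structure Element where
  origin : R3
  DF : Mat
  det_ne_zero : DF.det ≠ 0

namespace Element

variable (E : Element)

/-- The map `F` from the unit cube to the element. -/
def map (x : R3) : R3 := E.origin + E.DF *ᵥ x

/-- The inverse of `F`. -/
def invMap (x : R3) : R3 := E.DF⁻¹ *ᵥ (x - E.origin)

/-- `J = |det DF|`. -/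
def J : ℝ := |E.DF.det|

/-- The element as a closed subset of `ℝ³`. -/
def carrier : Set R3 := E.map '' refCube

/-- The faces of all dimensions (vertices, edges, facets) of the element. -/
def face (s : Fin 3 → Option Bool) : Set R3 := E.map '' refFace s

/-- The six two-dimensional faces of the element. -/
def facet (k : Fin 3) (b : Bool) : Set R3 :=
  E.face (Function.update (fun _ => none) k (some b))

/-- The row-wise Piola transform `τ = J⁻¹ (τ̂ ∘ F⁻¹) DFᵀ` of a reference stress. -/
def piola (τ : R3 → Mat) : R3 → Mat :=
  fun x => (1 / E.J) • (τ (E.invMap x) * E.DFᵀ)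

open Classical in
/-- The reference stress `τ̂` of which `τ` is the Piola transform on the element (it is unique,
because reference stresses are polynomials); zero if there is none. -/
def refStress (τ : R3 → Mat) : R3 → Mat :=
  if h : ∃ τ' : R3 → Mat, IsRefStress τ' ∧ τ =ᵐ[volume.restrict E.carrier] E.piola τ' then
    h.choose
  else 0

/-- The value at a point `x` of the closed element of a tensor field `A` that is continuous up
to the boundary of the element: the limit of `A` at `x` from inside, applied to `m`. -/
def traceTensor (A : R3 → Mat →ₗ[ℝ] Mat) (x : R3) (m : Mat) : Mat :=
  Filter.limUnder (𝓝[interior E.carrier] x) (fun y => A y m)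

/-- The vertex quadrature rule `(A τ, χ)_{Q,E}` on one element. -/
def quad (A : R3 → Mat →ₗ[ℝ] Mat) (τ χ : R3 → Mat) : ℝ :=
  1 / 8 * ∑ s : Fin 3 → Bool,
    frob
      (E.traceTensor A (E.map (refVertex s))
        ((1 / E.J) • (E.refStress τ (refVertex s) * E.DFᵀ)))
      (E.refStress χ (refVertex s) * E.DFᵀ)

end Element

/-- The elements `T i` form a conforming partition of `Ω`: they cover the closure of `Ω`, and two
different elements are disjoint or meet in a common vertex, a common edge or a common facet. -/
structure IsPartition {ι : Type*} (Ω : Set R3) (T : ι → Element) : Prop where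
  cover : closure Ω = ⋃ i, (T i).carrier
  conforming : ∀ i j, i ≠ j → Disjoint (T i).carrier (T j).carrier ∨
    ∃ s t : Fin 3 → Option Bool, (∃ k, s k ≠ none) ∧
      (T i).carrier ∩ (T j).carrier = (T i).face s ∧
      (T i).carrier ∩ (T j).carrier = (T j).face t

/-- `∂Ω = ΓD ∪ ΓN`, where `ΓD` is not empty and every boundary facet of the partition
belongs to exactly one of the two parts. -/
structure IsBoundarySplit {ι : Type*} (Ω : Set R3) (T : ι → Element) (ΓD ΓN : Set R3) :
    Prop where
  frontier_eq : frontier Ω = ΓD ∪ ΓN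
  nonempty : ΓD.Nonempty
  aligned : ∃ FD FN : Set (ι × Fin 3 × Bool), Disjoint FD FN ∧
    FD ∪ FN = {p | (T p.1).facet p.2.1 p.2.2 ⊆ frontier Ω} ∧
    ΓD = (⋃ p ∈ FD, (T p.1).facet p.2.1 p.2.2) ∧
    ΓN = (⋃ p ∈ FN, (T p.1).facet p.2.1 p.2.2)

/-- A compliance tensor: for every `x ∈ Ω` a linear operator on matrices that preserves symmetric
matrices, and that is symmetric, bounded and positive definite, uniformly in `x`. It is
continuous on every element, up to the boundary of the element, so that the vertex quadrature
rule is meaningful; it may jump from one element to the next. -/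
structure IsCompliance {ι : Type*} (Ω : Set R3) (T : ι → Element)
    (A : R3 → Mat →ₗ[ℝ] Mat) : Prop where
  maps_symm : ∀ x ∈ Ω, ∀ τ : Mat, τ.IsSymm → (A x τ).IsSymm
  symm : ∀ x ∈ Ω, ∀ σ τ : Mat, frob (A x σ) τ = frob σ (A x τ)
  bounded : ∃ C : ℝ, ∀ x ∈ Ω, ∀ τ : Mat, frob (A x τ) (A x τ) ≤ C * frob τ τ
  pos_def : ∃ α : ℝ, 0 < α ∧ ∀ x ∈ Ω, ∀ τ : Mat, α * frob τ τ ≤ frob (A x τ) τ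
  continuous : ∀ i, ∃ B : R3 → Mat →ₗ[ℝ] Mat,
    (∀ τ : Mat, ContinuousOn (fun x => B x τ) (T i).carrier) ∧
    ∀ x ∈ interior (T i).carrier, A x = B x

/-! ### The discrete spaces and the method -/

section Method

variable {ι : Type*} (Ω ΓD : Set R3) (T : ι → Element)

/-- The discrete stress space `𝕏ₕ`. -/
def IsDiscreteStress (τ : R3 → Mat) : Prop :=
  IsStress Ω ΓD τ ∧ ∀ i, ∃ τ' : R3 → Mat, IsRefStress τ' ∧
    τ =ᵐ[volume.restrict (T i).carrier] (T i).piola τ'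

/-- The discrete displacement space `Vₕ` of piecewise constant vector fields. -/
def IsDiscreteDisplacement (v : R3 → R3) : Prop :=
  IsDisplacement Ω v ∧ ∀ i, ∃ c : R3, v =ᵐ[volume.restrict (T i).carrier] fun _ => c

/-- The discrete rotation space `𝕎ₕ⁰` of piecewise constant skew-symmetric matrix fields. -/
def IsDiscreteRotation (w : R3 → Mat) : Prop :=
  IsRotation Ω w ∧ ∀ i, ∃ c : Mat, cᵀ = -c ∧
    w =ᵐ[volume.restrict (T i).carrier] fun _ => c

/-- The global vertex quadrature rule `(A τ, χ)_Q`. -/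
def quad [Fintype ι] (A : R3 → Mat →ₗ[ℝ] Mat) (τ χ : R3 → Mat) : ℝ :=
  ∑ i, (T i).quad A τ χ

/-- `(σ, u, γ) ∈ 𝕏ₕ × Vₕ × 𝕎ₕ⁰` solves the MSMFE-0 method. -/
structure IsSolution [Fintype ι] (A : R3 → Mat →ₗ[ℝ] Mat) (f : R3 → R3)
    (σ : R3 → Mat) (u : R3 → R3) (γ : R3 → Mat) : Prop where
  stress_mem : IsDiscreteStress Ω ΓD T σ
  displacement_mem : IsDiscreteDisplacement Ω T u
  rotation_mem : IsDiscreteRotation Ω T γ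
  constitutive : ∀ τ, IsDiscreteStress Ω ΓD T τ →
    quad T A σ τ + (∫ x in Ω, u x ⬝ᵥ matDiv Ω τ x) + (∫ x in Ω, frob (γ x) (τ x)) = 0
  equilibrium : ∀ v, IsDiscreteDisplacement Ω T v →
    (∫ x in Ω, matDiv Ω σ x ⬝ᵥ v x) = ∫ x in Ω, f x ⬝ᵥ v x
  weak_symmetry : ∀ w, IsDiscreteRotation Ω T w → (∫ x in Ω, frob (σ x) (w x)) = 0

end Method

end

end MSMFE

namespace MSMFE

noncomputable section

/-! ### Geometry of the elements -/

/-! In coordinates the method is a square linear system of saddle point form, so existence and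
uniqueness both follow from injectivity (`eq_zero_of_saddle`, `exists_saddle`). Two facts are
needed: the quadrature form is definite on the discrete stresses, and a pair (u, γ) with (u, div τ)
+ (γ, τ) = 0 for all discrete τ is zero.

Definiteness. The compliance is uniformly coercive and its limits at the vertices of an element
inherit the bound. So a stress with vanishing quadrature energy has a reference stress that vanishes
at all eight vertices of each element. A field of `ERT0` has 24 coefficients and is determined by
its 24 vertex values (`eq_zero_of_refVertex_eq_zero`).

Injectivity of the constraints. On an element E with barycentre c let ρ(x) = u + γ(x - c), the rigid
motion with mean u and skew gradient γ. If div τ is constant on E, then ∫ (u · div τ + γ : τ) = ∫ (ρ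
· div τ + ∇ρ : τ), which by Green's formula is the pairing of ρ with the normal flux of τ on ∂E.
Hence the constraints only see fluxes through facets. The reference space contains fields with
constant divergence whose flux is a prescribed affine function on one facet and zero on the five
others (`fluxField`). With the jump of ρ across a shared facet as flux, in opposite directions on
the two sides, the pairing becomes the integral of the squared jump. So the jump vanishes on the
facet, and a rigid motion that vanishes on a facet is zero (`eq_of_facet_eq`). With ρ itself as flux
through a facet in ΓD, one gets ρ = 0 on that element (`eq_zero_of_facet_subset`).

It remains to spread this over the partition. Elements that do not share a facet meet inside a line,
and finitely many lines do not disconnect a connected open set of ℝ³, so all elements are linked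
through facets (`IsPartition.forall_of_facet_adjacent`). Therefore every ρ is zero, and with it u
and γ. -/

theorem refCube_eq_Icc : refCube = Set.Icc (0 : R3) 1 := by
  ext x
  simp [refCube, Set.mem_Icc, Pi.le_def, forall_and]

theorem isCompact_refCube : IsCompact refCube := refCube_eq_Icc ▸ isCompact_Icc

theorem convex_refCube : Convex ℝ refCube := refCube_eq_Icc ▸ convex_Icc 0 1

theorem measurableSet_refCube : MeasurableSet refCube := isCompact_refCube.measurableSet

theorem interior_refCube : interior refCube = {x | ∀ i, 0 < x i ∧ x i < 1} := by
  rw [refCube_eq_Icc, ← Set.pi_univ_Icc, interior_pi_set Set.finite_univ]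
  ext x
  simp

theorem half_mem_interior_refCube : (fun _ => 1 / 2 : R3) ∈ interior refCube := by
  rw [interior_refCube]
  intro i
  norm_num

theorem nonempty_interior_refCube : (interior refCube).Nonempty := ⟨_, half_mem_interior_refCube⟩

theorem refVertex_mem_refCube (s : Fin 3 → Bool) : refVertex s ∈ refCube := by
  intro i
  unfold refVertex
  split_ifs <;> norm_num

theorem volume_refCube : volume refCube = 1 := by
  rw [refCube_eq_Icc, Real.volume_Icc_pi]
  simp

theorem volume_coord_eq (k : Fin 3) (b : ℝ) : volume {x : R3 | x k = b} = 0 :=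
  Measure.pi_hyperplane (α := fun _ : Fin 3 => ℝ) (fun _ => volume) k b

namespace Element

variable (E : Element)

theorem isUnit_det : IsUnit E.DF.det := E.det_ne_zero.isUnit

theorem J_pos : 0 < E.J := abs_pos.2 E.det_ne_zero

theorem invMap_map (x : R3) : E.invMap (E.map x) = x := by
  simp [invMap, map, Matrix.mulVec_mulVec, Matrix.nonsing_inv_mul _ E.isUnit_det]

theorem map_invMap (x : R3) : E.map (E.invMap x) = x := by
  simp [invMap, map, Matrix.mulVec_mulVec, Matrix.mul_nonsing_inv _ E.isUnit_det]

theorem map_add_sub (x y : R3) : E.map x - E.map y = E.DF *ᵥ (x - y) := by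
  simp [map, Matrix.mulVec_sub]

theorem continuous_map : Continuous E.map := by
  unfold map
  fun_prop

theorem continuous_invMap : Continuous E.invMap := by
  unfold invMap
  fun_prop

/-- The affine map of an element as a homeomorphism of `ℝ³`. -/
def homeo : R3 ≃ₜ R3 where
  toFun := E.map
  invFun := E.invMap
  left_inv := E.invMap_map
  right_inv := E.map_invMap
  continuous_toFun := E.continuous_map
  continuous_invFun := E.continuous_invMap

theorem map_injective : Function.Injective E.map := E.homeo.injective

theorem contDiff_map : ContDiff ℝ ∞ E.map := by
  have h : ContDiff ℝ ∞ (Matrix.toLin' E.DF).toContinuousLinearMap :=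
    ContinuousLinearMap.contDiff _
  exact contDiff_const.add h

theorem hasFDerivAt_map (x : R3) :
    HasFDerivAt E.map (Matrix.toLin' E.DF).toContinuousLinearMap x :=
  ((Matrix.toLin' E.DF).toContinuousLinearMap.hasFDerivAt (x := x)).const_add E.origin

theorem isCompact_carrier : IsCompact E.carrier := isCompact_refCube.image E.continuous_map

theorem isClosed_carrier : IsClosed E.carrier := E.isCompact_carrier.isClosed

theorem convex_carrier : Convex ℝ E.carrier := by
  have h := (convex_refCube.linear_image (Matrix.toLin' E.DF)).translate E.origin
  rw [Set.image_image] at h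
  exact h

theorem map_mem_carrier {x : R3} (hx : x ∈ refCube) : E.map x ∈ E.carrier := ⟨x, hx, rfl⟩

theorem interior_carrier : interior E.carrier = E.map '' interior refCube :=
  (E.homeo.image_interior refCube).symm

theorem map_mem_interior {x : R3} (hx : x ∈ interior refCube) :
    E.map x ∈ interior E.carrier := by
  rw [interior_carrier]
  exact ⟨x, hx, rfl⟩

theorem nonempty_interior : (interior E.carrier).Nonempty :=
  ⟨_, E.map_mem_interior half_mem_interior_refCube⟩

theorem closure_interior : closure (interior E.carrier) = E.carrier := by
  rw [E.convex_carrier.closure_interior_eq_closure_of_nonempty_interior E.nonempty_interior,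
    E.isClosed_carrier.closure_eq]

theorem volume_frontier : volume (frontier E.carrier) = 0 :=
  E.convex_carrier.addHaar_frontier volume

theorem interior_ae_eq : (interior E.carrier : Set R3) =ᵐ[volume] E.carrier :=
  interior_ae_eq_of_null_frontier E.volume_frontier

theorem restrict_interior :
    volume.restrict (interior E.carrier) = volume.restrict E.carrier :=
  Measure.restrict_congr_set E.interior_ae_eq

theorem volume_image {s : Set R3} (hs : volume s = 0) : volume (E.map '' s) = 0 :=
  addHaar_image_eq_zero_of_differentiableOn_of_addHaar_eq_zero volume
    (fun x _ => (E.hasFDerivAt_map x).differentiableAt.differentiableWithinAt) hs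

theorem face_subset_image {s : Fin 3 → Option Bool} {k : Fin 3} {b : Bool} (h : s k = some b) :
    E.face s ⊆ E.map '' {x | x k = if b then 1 else 0} := by
  refine Set.image_mono fun x hx => ?_
  cases b
  · simpa using (hx k).2.2.1 h
  · simpa using (hx k).2.2.2 h

theorem volume_face {s : Fin 3 → Option Bool} {k : Fin 3} (h : s k ≠ none) :
    volume (E.face s) = 0 := by
  obtain ⟨b, hb⟩ := Option.ne_none_iff_exists'.1 h
  exact measure_mono_null (E.face_subset_image hb) (E.volume_image (volume_coord_eq _ _))

theorem setIntegral_carrier (h : R3 → ℝ) :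
    ∫ x in E.carrier, h x = E.J * ∫ x in refCube, h (E.map x) := by
  rw [carrier, integral_image_eq_integral_abs_det_fderiv_smul volume measurableSet_refCube
    (fun x _ => (E.hasFDerivAt_map x).hasFDerivWithinAt) E.map_injective.injOn h]
  have : ((Matrix.toLin' E.DF).toContinuousLinearMap).det = E.DF.det := by
    rw [ContinuousLinearMap.det, LinearMap.coe_toContinuousLinearMap, LinearMap.det_toLin']
  simp only [this, smul_eq_mul]
  rw [integral_const_mul]
  rfl

theorem volume_carrier_lt_top : volume E.carrier < ⊤ := E.isCompact_carrier.measure_lt_top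

theorem eqOn_of_ae_eq {M : Type*} [TopologicalSpace M] [T2Space M] {g h : R3 → M}
    (hg : Continuous g) (hh : Continuous h) (hgh : g =ᵐ[volume.restrict E.carrier] h) :
    Set.EqOn g h E.carrier := by
  exact Measure.eqOn_of_ae_eq hgh hg.continuousOn hh.continuousOn E.closure_interior.ge

end Element

/-! ### Partitions -/

namespace IsPartition

variable {ι : Type*} {Ω : Set R3} {T : ι → Element}

theorem carrier_subset (hT : IsPartition Ω T) (i : ι) : (T i).carrier ⊆ closure Ω := by
  rw [hT.cover]
  exact Set.subset_iUnion (fun i => (T i).carrier) i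

theorem interior_subset (hT : IsPartition Ω T) (hΩ : interior (closure Ω) = Ω) (i : ι) :
    interior (T i).carrier ⊆ Ω :=
  (interior_mono (hT.carrier_subset i)).trans hΩ.subset

theorem volume_inter (hT : IsPartition Ω T) {i j : ι} (hij : i ≠ j) :
    volume ((T i).carrier ∩ (T j).carrier) = 0 := by
  rcases hT.conforming i j hij with h | ⟨s, t, ⟨k, hk⟩, h, -⟩
  · rw [h.inter_eq]
    exact measure_empty
  · rw [h]
    exact (T i).volume_face hk

theorem disjoint_interior (hT : IsPartition Ω T) {i j : ι} (hij : i ≠ j) :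
    Disjoint (interior (T i).carrier) (interior (T j).carrier) := by
  rw [Set.disjoint_iff_inter_eq_empty]
  refine ((isOpen_interior.inter isOpen_interior).measure_eq_zero_iff volume).1 ?_
  exact measure_mono_null (Set.inter_subset_inter _root_.interior_subset _root_.interior_subset)
    (hT.volume_inter hij)

variable [Fintype ι]

/-- A point of Ω outside all open elements lies on the boundary of an element, and boundaries of
convex sets are null. Conversely the open elements lie in the interior of the closure of Ω, which is
Ω because there are no slits. -/
theorem ae_eq_iUnion (hT : IsPartition Ω T) (hΩ : interior (closure Ω) = Ω) :
    Ω =ᵐ[volume] ⋃ i, interior (T i).carrier := by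
  have h0 : volume (⋃ i, frontier (T i).carrier) = 0 :=
    measure_iUnion_null fun i => (T i).volume_frontier
  have hsub : (⋃ i, interior (T i).carrier) ⊆ Ω := Set.iUnion_subset (hT.interior_subset hΩ)
  refine (ae_le_set.2 (measure_mono_null ?_ h0)).antisymm (hsub.eventuallyLE)
  rintro x ⟨hx, hx'⟩
  have := subset_closure hx
  rw [hT.cover] at this
  obtain ⟨i, hi⟩ := Set.mem_iUnion.1 this
  refine Set.mem_iUnion.2 ⟨i, subset_closure hi, fun h => hx' (Set.mem_iUnion.2 ⟨i, h⟩)⟩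

theorem restrict_eq (hT : IsPartition Ω T) (hΩ : interior (closure Ω) = Ω) :
    volume.restrict Ω = volume.restrict (⋃ i, interior (T i).carrier) :=
  Measure.restrict_congr_set (hT.ae_eq_iUnion hΩ)

theorem ae_iff (hT : IsPartition Ω T) (hΩ : interior (closure Ω) = Ω) (p : R3 → Prop) :
    (∀ᵐ x ∂volume.restrict Ω, p x) ↔ ∀ i, ∀ᵐ x ∂volume.restrict (T i).carrier, p x := by
  rw [hT.restrict_eq hΩ, ae_restrict_iUnion_iff]
  simp only [Element.restrict_interior]

theorem setIntegral_eq_sum (hT : IsPartition Ω T) (hΩ : interior (closure Ω) = Ω) {h : R3 → ℝ}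
    (hh : ∀ i, IntegrableOn h (T i).carrier) :
    ∫ x in Ω, h x = ∑ i, ∫ x in (T i).carrier, h x := by
  rw [hT.restrict_eq hΩ, integral_iUnion_fintype (fun i => isOpen_interior.measurableSet)
    (fun i j hij => hT.disjoint_interior hij)
    (fun i => (hh i).mono_set _root_.interior_subset)]
  simp only [Element.restrict_interior]

end IsPartition

/-! ### Fields given element by element -/

/-- The field that agrees with `g i` in the interior of the element `T i`. -/
def glue {ι M : Type*} [Fintype ι] [AddCommMonoid M] (T : ι → Element) (g : ι → R3 → M) :
    R3 → M :=
  fun x => ∑ i, (interior (T i).carrier).indicator (g i) x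

section Glue

variable {ι M : Type*} [Fintype ι] {Ω : Set R3} {T : ι → Element}

theorem glue_apply [AddCommMonoid M] (hT : IsPartition Ω T) (g : ι → R3 → M) {i : ι} {x : R3}
    (hx : x ∈ interior (T i).carrier) : glue T g x = g i x := by
  unfold glue
  rw [Finset.sum_eq_single i, Set.indicator_of_mem hx]
  · intro j _ hj
    exact Set.indicator_of_notMem
      (fun h => Set.disjoint_left.1 (hT.disjoint_interior hj) h hx) _
  · simp

theorem glue_ae_eq [AddCommMonoid M] (hT : IsPartition Ω T) (g : ι → R3 → M) (i : ι) :
    glue T g =ᵐ[volume.restrict (T i).carrier] g i := by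
  rw [← Element.restrict_interior]
  filter_upwards [ae_restrict_mem isOpen_interior.measurableSet] with x hx
  exact glue_apply hT g hx

theorem ae_eq_glue [AddCommMonoid M] (hT : IsPartition Ω T) (hΩ : interior (closure Ω) = Ω)
    {g : ι → R3 → M} {τ : R3 → M} (h : ∀ i, τ =ᵐ[volume.restrict (T i).carrier] g i) :
    τ =ᵐ[volume.restrict Ω] glue T g :=
  (hT.ae_iff hΩ _).2 fun i => (h i).trans (glue_ae_eq hT g i).symm

theorem ae_eq_carrier_of_ae_eq (hT : IsPartition Ω T) (hΩ : interior (closure Ω) = Ω)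
    {σ τ : R3 → M} (h : σ =ᵐ[volume.restrict Ω] τ) (i : ι) :
    σ =ᵐ[volume.restrict (T i).carrier] τ :=
  (hT.ae_iff hΩ _).1 h i

theorem glue_add [AddCommMonoid M] (g h : ι → R3 → M) :
    glue T (g + h) = glue T g + glue T h := by
  ext x
  simp only [glue, Pi.add_apply, ← Finset.sum_add_distrib]
  refine Finset.sum_congr rfl fun i _ => ?_
  exact congrFun (Set.indicator_add _ (g i) (h i)) x

theorem glue_smul [AddCommMonoid M] [Module ℝ M] (c : ℝ) (g : ι → R3 → M) :
    glue T (c • g) = c • glue T g := by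
  ext x
  simp only [glue, Pi.smul_apply, Finset.smul_sum]
  refine Finset.sum_congr rfl fun i _ => ?_
  exact congrFun (Set.indicator_const_smul _ c (g i)) x

theorem isL2_of_ae_eq_continuous (hT : IsPartition Ω T) (hΩ : interior (closure Ω) = Ω)
    {g : ι → R3 → ℝ} (hg : ∀ i, Continuous (g i)) {τ : R3 → ℝ}
    (h : ∀ i, τ =ᵐ[volume.restrict (T i).carrier] g i) : IsL2 Ω τ := by
  refine MemLp.ae_eq (ae_eq_glue hT hΩ h).symm ?_
  refine MemLp.restrict Ω ?_
  have : glue T g = ∑ i, (interior (T i).carrier).indicator (g i) := by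
    ext x
    simp [glue]
  rw [this]
  refine memLp_finsetSum' _ fun i _ => ?_
  rw [memLp_indicator_iff_restrict isOpen_interior.measurableSet, Element.restrict_interior]
  rw [memLp_two_iff_integrable_sq (hg i).aestronglyMeasurable]
  exact ((hg i).pow 2).continuousOn.integrableOn_compact (T i).isCompact_carrier

end Glue

/-! ### The enhanced Raviart-Thomas space -/

theorem exists_of_mem_RT0 {q : R3 → R3} (hq : q ∈ RT0) :
    ∃ α β : R3, q = fun x i => α i + β i * x i := by
  induction hq using Submodule.span_induction with
  | mem q h => exact h
  | zero => exact ⟨0, 0, by ext; simp⟩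
  | add q r _ _ hq hr =>
    obtain ⟨α, β, rfl⟩ := hq
    obtain ⟨α', β', rfl⟩ := hr
    exact ⟨α + α', β + β', by ext x i; simp; ring⟩
  | smul c q _ hq =>
    obtain ⟨α, β, rfl⟩ := hq
    exact ⟨c • α, c • β, by ext x i; simp; ring⟩

theorem exists_of_mem_ERT0 {q : R3 → R3} (hq : q ∈ ERT0) :
    ∃ (α β : R3) (c : Fin 18 → ℝ), q = fun x => ![
      α 0 + β 0 * x 0 - 3 * c 0 * x 1 - 3 * c 1 * x 2 - 4 * c 2 * x 1 * x 2
        - 3 * c 3 * x 0 * x 1 - 3 * c 4 * x 0 * x 2 - 4 * c 5 * x 0 * x 1 * x 2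
        + c 9 * x 0 ^ 2 + c 10 * x 0 * x 2 + c 11 * x 0 ^ 2 * x 2
        + c 15 * x 0 ^ 2 + c 16 * x 0 * x 1 + c 17 * x 0 ^ 2 * x 1,
      α 1 + β 1 * x 1 - 3 * c 6 * x 0 - 3 * c 7 * x 2 - 4 * c 8 * x 0 * x 2
        - 3 * c 9 * x 0 * x 1 - 3 * c 10 * x 1 * x 2 - 4 * c 11 * x 0 * x 1 * x 2
        + c 3 * x 1 ^ 2 + c 4 * x 1 * x 2 + c 5 * x 1 ^ 2 * x 2
        + c 15 * x 0 * x 1 + c 16 * x 1 ^ 2 + c 17 * x 0 * x 1 ^ 2,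
      α 2 + β 2 * x 2 - 3 * c 12 * x 0 - 3 * c 13 * x 1 - 4 * c 14 * x 0 * x 1
        - 3 * c 15 * x 0 * x 2 - 3 * c 16 * x 1 * x 2 - 4 * c 17 * x 0 * x 1 * x 2
        + c 3 * x 1 * x 2 + c 4 * x 2 ^ 2 + c 5 * x 1 * x 2 ^ 2
        + c 9 * x 0 * x 2 + c 10 * x 2 ^ 2 + c 11 * x 0 * x 2 ^ 2] := by
  obtain ⟨r, hr, s, hs, rfl⟩ := Submodule.mem_sup.1 hq
  obtain ⟨α, β, rfl⟩ := exists_of_mem_RT0 hr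
  simp only [curlBubble, Submodule.mem_span_insert, Submodule.mem_span_singleton] at hs
  obtain ⟨c0, _, ⟨c1, _, ⟨c2, _, ⟨c3, _, ⟨c4, _, ⟨c5, _, ⟨c6, _, ⟨c7, _, ⟨c8, _, ⟨c9, _,
    ⟨c10, _, ⟨c11, _, ⟨c12, _, ⟨c13, _, ⟨c14, _, ⟨c15, _, ⟨c16, _, ⟨c17, rfl⟩, rfl⟩, rfl⟩,
    rfl⟩, rfl⟩, rfl⟩, rfl⟩, rfl⟩, rfl⟩, rfl⟩, rfl⟩, rfl⟩, rfl⟩, rfl⟩, rfl⟩, rfl⟩, rfl⟩,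
    rfl⟩ := hs
  refine ⟨α, β, ![c0, c1, c2, c3, c4, c5, c6, c7, c8, c9, c10, c11, c12, c13, c14, c15, c16,
    c17], ?_⟩
  ext x i
  fin_cases i <;> simp <;> ring

theorem continuous_of_mem_ERT0 {q : R3 → R3} (hq : q ∈ ERT0) : Continuous q := by
  obtain ⟨α, β, c, rfl⟩ := exists_of_mem_ERT0 hq
  refine continuous_pi fun i => ?_
  fin_cases i <;> dsimp <;> fun_prop

/-- Unisolvence of the vertex values. At the vertices every square equals its variable, so the
values determine the trilinear interpolant of each component. Its coefficients are compared with the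
parameters α, β, c. -/
theorem eq_zero_of_refVertex_eq_zero {q : R3 → R3} (hq : q ∈ ERT0)
    (h : ∀ s, q (refVertex s) = 0) : q = 0 := by
  obtain ⟨α, β, c, rfl⟩ := exists_of_mem_ERT0 hq
  have h' := fun s0 s1 s2 : Bool =>
    And.intro (congrFun (h ![s0, s1, s2]) 0)
      (And.intro (congrFun (h ![s0, s1, s2]) 1) (congrFun (h ![s0, s1, s2]) 2))
  obtain ⟨p0, p1, p2⟩ := h' false false false
  obtain ⟨x0, x1, x2⟩ := h' true false false
  obtain ⟨y0, y1, y2⟩ := h' false true false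
  obtain ⟨z0, z1, z2⟩ := h' false false true
  obtain ⟨xy0, xy1, xy2⟩ := h' true true false
  obtain ⟨xz0, xz1, xz2⟩ := h' true false true
  obtain ⟨yz0, yz1, yz2⟩ := h' false true true
  obtain ⟨xyz0, xyz1, xyz2⟩ := h' true true true
  simp [refVertex] at p0 p1 p2 x0 x1 x2 y0 y1 y2 z0 z1 z2
  simp [refVertex] at xy0 xy1 xy2 xz0 xz1 xz2 yz0 yz1 yz2 xyz0 xyz1 xyz2
  clear h h' hq
  -- The coefficients of the monomials that omit the variable of their own component isolate `c 0`,
  -- `c 1`, `c 2` and their analogues; those of xyz isolate `c 5`, `c 11`, `c 17`. The remaining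
  -- parameters come in the pairs (3, 16), (4, 10), (9, 15), each subject to -3s + t = 0 and s - 3t
  -- = 0. Only then do the linear terms give β = 0.
  have c0 : c 0 = 0 := by linarith
  have c1 : c 1 = 0 := by linarith
  have c6 : c 6 = 0 := by linarith
  have c7 : c 7 = 0 := by linarith
  have c12 : c 12 = 0 := by linarith
  have c13 : c 13 = 0 := by linarith
  have c2 : c 2 = 0 := by linarith
  have c8 : c 8 = 0 := by linarith
  have c14 : c 14 = 0 := by linarith
  have c5 : c 5 = 0 := by linarith
  have c11 : c 11 = 0 := by linarith
  have c17 : c 17 = 0 := by linarith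
  have c3 : c 3 = 0 := by linarith
  have c16 : c 16 = 0 := by linarith
  have c4 : c 4 = 0 := by linarith
  have c10 : c 10 = 0 := by linarith
  have c9 : c 9 = 0 := by linarith
  have c15 : c 15 = 0 := by linarith
  have b0 : β 0 = 0 := by linarith
  have b1 : β 1 = 0 := by linarith
  have b2 : β 2 = 0 := by linarith
  ext x i
  fin_cases i <;>
    simp [p0, p1, p2, b0, b1, b2, c0, c1, c2, c3, c4, c5, c6, c7, c8, c9, c10, c11, c12, c13, c14,
      c15, c16, c17]

instance : FiniteDimensional ℝ ERT0 := by
  let ev : ERT0 →ₗ[ℝ] ((Fin 3 → Bool) → R3) :=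
    { toFun := fun q s => q.1 (refVertex s)
      map_add' := fun _ _ => rfl
      map_smul' := fun _ _ => rfl }
  refine FiniteDimensional.of_injective ev ((injective_iff_map_eq_zero ev).2 fun q hq => ?_)
  exact Subtype.ext (eq_zero_of_refVertex_eq_zero q.2 fun s => congrFun hq s)

/-! ### Fields with an affine flux through one facet -/

/-- The coordinate of a facet of the cube as a real number. -/
def side (b : Bool) : ℝ := if b then 1 else 0

/-- A field on the cube with constant divergence `a` whose outward flux through the facet `(k, b)`
is `a + ∑ βₗ (xₗ - 1 / 2)`, provided that `βₖ = 0`, and which has no flux through the other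
facets. -/
def fluxField (k : Fin 3) (b : Bool) (a : ℝ) (β : R3) : R3 → R3 := fun x j =>
  β j * (x j * (1 - x j) / 2) +
    if j = k then (x k - 1 + side b) * (a + ∑ l, β l * (x l - 1 / 2)) else 0

theorem axis_mem_RT0 (α β : R3) : (fun x : R3 => fun i => α i + β i * x i) ∈ RT0 :=
  Submodule.subset_span ⟨α, β, rfl⟩

theorem coord_single_mem_ERT0 {k l : Fin 3} (hkl : k ≠ l) :
    (fun x i => if i = k then x l else 0 : R3 → R3) ∈ ERT0 := by
  have key : ∀ q : R3 → R3, (-3 : ℝ) • q ∈ curlBubble → q ∈ ERT0 := fun q hq =>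
    Submodule.mem_sup_right (by simpa using curlBubble.smul_mem (-3)⁻¹ hq)
  have aux : ∀ q r : R3 → R3, r ∈ curlBubble → (∀ x, r x = (-3 : ℝ) • q x) → q ∈ ERT0 :=
    fun q r hr h => key q ((funext h : r = (-3 : ℝ) • q) ▸ hr)
  revert hkl
  match k, l with
  | 0, 0 => exact fun h => absurd rfl h
  | 1, 1 => exact fun h => absurd rfl h
  | 2, 2 => exact fun h => absurd rfl h
  | 0, 1 =>
    intro
    refine aux _ (fun x => ![-3 * x 1, 0, 0]) (Submodule.subset_span (by simp)) fun x => ?_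
    ext i; fin_cases i <;> simp
  | 0, 2 =>
    intro
    refine aux _ (fun x => ![-3 * x 2, 0, 0]) (Submodule.subset_span (by simp)) fun x => ?_
    ext i; fin_cases i <;> simp
  | 1, 0 =>
    intro
    refine aux _ (fun x => ![0, -3 * x 0, 0]) (Submodule.subset_span (by simp)) fun x => ?_
    ext i; fin_cases i <;> simp
  | 1, 2 =>
    intro
    refine aux _ (fun x => ![0, -3 * x 2, 0]) (Submodule.subset_span (by simp)) fun x => ?_
    ext i; fin_cases i <;> simp
  | 2, 0 =>
    intro
    refine aux _ (fun x => ![0, 0, -3 * x 0]) (Submodule.subset_span (by simp)) fun x => ?_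
    ext i; fin_cases i <;> simp
  | 2, 1 =>
    intro
    refine aux _ (fun x => ![0, 0, -3 * x 1]) (Submodule.subset_span (by simp)) fun x => ?_
    ext i; fin_cases i <;> simp

/-- This field is curl (x × m eₖ) with m = xₖ xₗ, since curl (x × m eₖ) = (∂ₖ m) x - (2 + deg m) m
eₖ. The six cases are six of the generators. -/
theorem coord_mul_mem_ERT0 {k l : Fin 3} (hkl : k ≠ l) :
    (fun x i => x l * (x i - if i = k then 4 * x i else 0) : R3 → R3) ∈ ERT0 := by
  have aux : ∀ q r : R3 → R3, r ∈ curlBubble → (∀ x, q x = r x) → q ∈ ERT0 :=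
    fun q r hr h => Submodule.mem_sup_right ((funext h : q = r) ▸ hr)
  revert hkl
  match k, l with
  | 0, 0 => exact fun h => absurd rfl h
  | 1, 1 => exact fun h => absurd rfl h
  | 2, 2 => exact fun h => absurd rfl h
  | 0, 1 =>
    intro
    refine aux _ (fun x => ![-3 * x 0 * x 1, x 1 ^ 2, x 1 * x 2])
      (Submodule.subset_span (by simp)) fun x => ?_
    ext i; fin_cases i <;> simp <;> ring
  | 0, 2 =>
    intro
    refine aux _ (fun x => ![-3 * x 0 * x 2, x 1 * x 2, x 2 ^ 2])
      (Submodule.subset_span (by simp)) fun x => ?_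
    ext i; fin_cases i <;> simp <;> ring
  | 1, 0 =>
    intro
    refine aux _ (fun x => ![x 0 ^ 2, -3 * x 0 * x 1, x 0 * x 2])
      (Submodule.subset_span (by simp)) fun x => ?_
    ext i; fin_cases i <;> simp <;> ring
  | 1, 2 =>
    intro
    refine aux _ (fun x => ![x 0 * x 2, -3 * x 1 * x 2, x 2 ^ 2])
      (Submodule.subset_span (by simp)) fun x => ?_
    ext i; fin_cases i <;> simp <;> ring
  | 2, 0 =>
    intro
    refine aux _ (fun x => ![x 0 ^ 2, x 0 * x 1, -3 * x 0 * x 2])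
      (Submodule.subset_span (by simp)) fun x => ?_
    ext i; fin_cases i <;> simp <;> ring
  | 2, 1 =>
    intro
    refine aux _ (fun x => ![x 0 * x 1, x 1 ^ 2, -3 * x 1 * x 2])
      (Submodule.subset_span (by simp)) fun x => ?_
    ext i; fin_cases i <;> simp <;> ring

/-- A divergence-free field whose k-th component carries xₗ on the facet xₖ = 1. It supplies the
non-constant part of an affine flux, and the term -xₗ² / 2 is corrected later by a term of `RT0`. -/
theorem coord_bubble_mem_ERT0 {k l : Fin 3} (hkl : k ≠ l) :
    (fun x i => (if i = k then x k * x l else 0) - if i = l then x l ^ 2 / 2 else 0 : R3 → R3)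
      ∈ ERT0 := by
  obtain ⟨m, hmk, hml, hm⟩ : ∃ m, m ≠ k ∧ m ≠ l ∧ ∀ i, i = k ∨ i = l ∨ i = m := by
    decide +revert
  -- With m the third index, the weights 3 and 1 cancel the m-th component; the k-th and l-th
  -- components become -8 xₖ xₗ and 4 xₗ².
  have h := ERT0.smul_mem (-1 / 8) (ERT0.add_mem (ERT0.smul_mem 3 (coord_mul_mem_ERT0 hkl))
    (coord_mul_mem_ERT0 hml))
  convert h using 1
  ext x i
  rcases hm i with rfl | rfl | rfl
  · simp [hkl, hmk.symm]; ring
  · simp [hkl.symm, hml.symm]; ring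
  · simp [hmk, hml]; ring

theorem fluxField_mem_ERT0 (k : Fin 3) (b : Bool) (a : ℝ) {β : R3} (hβ : β k = 0) :
    fluxField k b a β ∈ ERT0 := by
  -- The Raviart-Thomas part holds the constant a - ∑ βₗ / 2 of the flux and the linear halves of
  -- the bubbles βᵢ xᵢ (1 - xᵢ) / 2. The second sum below holds what varies along the facet; its
  -- term l = k, for which no field is available, drops out because βₖ = 0.
  have h1 : (fun x i => (if i = k then -(1 - side b) * (a - (∑ l, β l) / 2) else β i * 0)
      + (if i = k then a - (∑ l, β l) / 2 else β i / 2) * x i : R3 → R3) ∈ ERT0 :=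
    Submodule.mem_sup_left (axis_mem_RT0 (fun i => if i = k then _ else β i * 0)
      (fun i => if i = k then _ else β i / 2))
  have h2 : ∑ l, β l • (fun x i => (if i = k then x k * x l else 0) -
      (if i = l then x l ^ 2 / 2 else 0) + (-(1 - side b)) * (if i = k then x l else 0) : R3 → R3)
      ∈ ERT0 := by
    refine ERT0.sum_mem fun l _ => ?_
    rcases eq_or_ne k l with rfl | hkl
    · rw [hβ, zero_smul]
      exact ERT0.zero_mem
    · exact ERT0.smul_mem _ (ERT0.add_mem (coord_bubble_mem_ERT0 hkl)
        (ERT0.smul_mem _ (coord_single_mem_ERT0 hkl)))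
  convert ERT0.add_mem h1 h2 using 1
  ext x i
  simp only [fluxField, Pi.add_apply, Finset.sum_apply, Pi.smul_apply, smul_eq_mul]
  rcases eq_or_ne i k with rfl | hik
  · simp only [if_true, hβ]
    simp only [Fin.sum_univ_three]
    have : ∀ l, β l * (if i = l then x l ^ 2 / 2 else 0) = 0 := by
      intro l
      split_ifs with h
      · rw [← h, hβ, zero_mul]
      · simp
    linear_combination this 0 + this 1 + this 2
  · simp [hik]
    ring

/-! ### Green's formula on the cube -/

theorem setIntegral_refCube (k : Fin 3) {G : R3 → ℝ} (hG : Continuous G) :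
    ∫ x in refCube, G x =
      ∫ y in Set.Icc (0 : Fin 2 → ℝ) 1, ∫ t in (0 : ℝ)..1, G (k.insertNth t y) := by
  have hc : Continuous fun p : ℝ × (Fin 2 → ℝ) => (k.insertNth p.1 p.2 : R3) := by
    fun_prop
  have e := (volume_preserving_piFinSuccAbove (fun _ : Fin 3 => ℝ) k).symm
  have h1 := e.setIntegral_preimage_emb
    (MeasurableEquiv.measurableEmbedding _) G refCube
  rw [← h1]
  have hpre : (MeasurableEquiv.piFinSuccAbove (fun _ : Fin 3 => ℝ) k).symm ⁻¹' refCube =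
      Set.Icc (0 : ℝ) 1 ×ˢ Set.Icc (0 : Fin 2 → ℝ) 1 := by
    ext ⟨t, y⟩
    simp only [Set.mem_preimage, refCube, Set.mem_ofPred_eq, Set.mem_prod, Set.mem_Icc, Pi.le_def,
      Fin.forall_iff_succAbove k, MeasurableEquiv.piFinSuccAbove_symm_apply,
      Fin.insertNthEquiv, Equiv.coe_fn_mk, Fin.insertNth_apply_same,
      Fin.insertNth_apply_succAbove, Pi.zero_apply, Pi.one_apply, forall_and]
    tauto
  rw [hpre]
  have hint : IntegrableOn (fun p : ℝ × (Fin 2 → ℝ) => G (k.insertNth p.1 p.2))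
      (Set.Icc (0 : ℝ) 1 ×ˢ Set.Icc (0 : Fin 2 → ℝ) 1) (volume.prod volume) :=
    (hG.comp hc).continuousOn.integrableOn_compact (isCompact_Icc.prod isCompact_Icc)
  have h2 := setIntegral_prod_swap (μ := volume) (ν := volume) (Set.Icc (0 : ℝ) 1)
    (Set.Icc (0 : Fin 2 → ℝ) 1) (fun p : ℝ × (Fin 2 → ℝ) => G (k.insertNth p.1 p.2))
  refine h2.symm.trans ((setIntegral_prod _ hint.swap).trans ?_)
  refine setIntegral_congr_fun measurableSet_Icc fun y _ => ?_
  rw [intervalIntegral.integral_of_le zero_le_one, integral_Icc_eq_integral_Ioc]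
  rfl

/-- Freezing one coordinate makes the integrand constant in a direction of unit length. This is how
facet integrals are represented from here on: as integrals over the whole cube, with the coordinate
normal to the facet frozen. -/
theorem setIntegral_refCube_update (k : Fin 3) (s : ℝ) {G : R3 → ℝ} (hG : Continuous G) :
    ∫ x in refCube, G (Function.update x k s) =
      ∫ y in Set.Icc (0 : Fin 2 → ℝ) 1, G (k.insertNth s y) := by
  have hu : Continuous fun x : R3 => Function.update x k s :=
    continuous_id.update k continuous_const
  refine (setIntegral_refCube k (hG.comp hu)).trans ?_
  simp [Fin.update_insertNth]

theorem setIntegral_refCube_deriv (k : Fin 3) {G D : R3 → ℝ} (hG : Continuous G)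
    (hD : Continuous D) (h : ∀ x t, HasDerivAt (fun t => G (Function.update x k t))
      (D (Function.update x k t)) t) :
    ∫ x in refCube, D x = (∫ x in refCube, G (Function.update x k 1)) -
      ∫ x in refCube, G (Function.update x k 0) := by
  have hi : ∀ s : ℝ, Continuous fun y : Fin 2 → ℝ => (k.insertNth s y : R3) := fun s => by
    fun_prop
  rw [setIntegral_refCube k hD, setIntegral_refCube_update k _ hG,
    setIntegral_refCube_update k _ hG, ← integral_sub]
  · refine setIntegral_congr_fun measurableSet_Icc fun y _ => ?_
    have h' : ∀ t, HasDerivAt (fun t => G (k.insertNth t y)) (D (k.insertNth t y)) t := by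
      intro t
      have := h (k.insertNth 0 y) t
      simpa only [Fin.update_insertNth] using this
    refine intervalIntegral.integral_eq_sub_of_hasDerivAt (fun t _ => h' t) ?_
    have : Continuous fun t : ℝ => (k.insertNth t y : R3) := by fun_prop
    exact (hD.comp this).intervalIntegrable _ _
  · exact (hG.comp (hi 1)).continuousOn.integrableOn_compact isCompact_Icc
  · exact (hG.comp (hi 0)).continuousOn.integrableOn_compact isCompact_Icc

theorem hasDerivAt_update_comp {φ : R3 → ℝ} (hφ : Differentiable ℝ φ) (x : R3) (j : Fin 3)
    (t : ℝ) : HasDerivAt (fun t => φ (Function.update x j t))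
      (partialDeriv j φ (Function.update x j t)) t :=
  (hφ _).hasFDerivAt.comp_hasDerivAt t (hasDerivAt_update x j t)

theorem continuous_partialDeriv {φ : R3 → ℝ} (hφ : ContDiff ℝ ∞ φ) (j : Fin 3) :
    Continuous (partialDeriv j φ) :=
  (hφ.continuous_fderiv (by simp)).clm_apply continuous_const

theorem sum_mul_update {k : Fin 3} {β : R3} (hβ : β k = 0) (x : R3) (t : ℝ) :
    ∑ l, β l * (Function.update x k t l - 1 / 2) = ∑ l, β l * (x l - 1 / 2) := by
  refine Finset.sum_congr rfl fun l _ => ?_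
  rcases eq_or_ne l k with rfl | h
  · simp [hβ]
  · rw [Function.update_of_ne h]

theorem continuous_fluxField (k : Fin 3) (b : Bool) (a : ℝ) (β : R3) :
    Continuous (fluxField k b a β) := by
  refine continuous_pi fun j => ?_
  unfold fluxField
  split_ifs <;> fun_prop

theorem hasDerivAt_fluxField {k : Fin 3} (b : Bool) (a : ℝ) {β : R3} (hβ : β k = 0) (x : R3)
    (j : Fin 3) (t : ℝ) :
    HasDerivAt (fun t => fluxField k b a β (Function.update x j t) j)
      (β j * (1 / 2 - t) + if j = k then a + ∑ l, β l * (x l - 1 / 2) else 0) t := by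
  have h1 : HasDerivAt (fun t : ℝ => β j * (t * (1 - t) / 2)) (β j * (1 / 2 - t)) t := by
    have := ((((hasDerivAt_id t).mul ((hasDerivAt_id t).const_sub 1)).div_const 2).const_mul (β j))
    refine this.congr_deriv ?_
    simp only [id]
    ring
  unfold fluxField
  rcases eq_or_ne j k with rfl | h
  · simp only [if_true, Function.update_self, sum_mul_update hβ]
    have := (((hasDerivAt_id t).sub_const 1).add_const (side b)).mul_const
      (a + ∑ l, β l * (x l - 1 / 2))
    rw [one_mul] at this
    exact h1.add this
  · simpa [h] using h1

/-- The divergence theorem, one coordinate at a time. Only the facet (k, b) contributes, because the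
bubbles xⱼ (1 - xⱼ) vanish on the facets normal to eⱼ and the remaining factor vanishes on the facet
opposite to (k, b). -/
theorem green_refCube {k : Fin 3} (b : Bool) (a : ℝ) {β : R3} (hβ : β k = 0) {ψ : R3 → ℝ}
    (hψ : ContDiff ℝ ∞ ψ) :
    ∫ x in refCube, ((∑ j, fluxField k b a β x j * partialDeriv j ψ x) + a * ψ x) =
      ∫ x in refCube, (a + ∑ l, β l * (x l - 1 / 2)) * ψ (Function.update x k (side b)) := by
  have hq := fun j => (continuous_apply j).comp (continuous_fluxField k b a β)
  have hψd : Differentiable ℝ ψ := hψ.differentiable (by simp)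
  -- `D j` is the j-th partial derivative of `fluxField k b a β x j * ψ x`. In the sum over j the
  -- terms βⱼ (1 / 2 - xⱼ) and βₗ (xₗ - 1 / 2) cancel, leaving the constant divergence a.
  let D : Fin 3 → R3 → ℝ := fun j x => fluxField k b a β x j * partialDeriv j ψ x +
    (β j * (1 / 2 - x j) + if j = k then a + ∑ l, β l * (x l - 1 / 2) else 0) * ψ x
  have hD : ∀ j, Continuous (D j) := by
    intro j
    have h2 : Continuous fun x : R3 =>
        (β j * (1 / 2 - x j) + if j = k then a + ∑ l, β l * (x l - 1 / 2) else 0) := by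
      split_ifs <;> fun_prop
    exact ((hq j).mul (continuous_partialDeriv hψ j)).add (h2.mul hψ.continuous)
  have key : ∀ j, ∫ x in refCube, D j x = if j = k then
      ∫ x in refCube, (a + ∑ l, β l * (x l - 1 / 2)) * ψ (Function.update x k (side b)) else 0 := by
    intro j
    rw [setIntegral_refCube_deriv j (G := fun x => fluxField k b a β x j * ψ x)
      ((hq j).mul hψ.continuous) (hD j)]
    · rcases eq_or_ne j k with rfl | h
      · simp only [fluxField, if_true, Function.update_self, sum_mul_update hβ, hβ]
        cases b
        · simp only [side, Bool.false_eq_true, if_false, zero_mul, sub_self, add_zero, zero_add,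
            zero_sub, neg_mul, one_mul, integral_neg, sub_neg_eq_add, integral_zero]
        · simp [side]
      · simp [fluxField, h]
    · intro x t
      have := (hasDerivAt_fluxField b a hβ x j t).mul (hasDerivAt_update_comp hψd x j t)
      refine this.congr_deriv ?_
      simp only [D, Function.update_self]
      split_ifs with h
      · subst h
        rw [sum_mul_update hβ]
        ring
      · ring
  have hsum : ∀ x, ((∑ j, fluxField k b a β x j * partialDeriv j ψ x) + a * ψ x) =
      ∑ j, D j x := by
    intro x
    simp only [D, Finset.sum_add_distrib, ← Finset.sum_mul, add_right_inj]
    congr 1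
    simp only [Finset.sum_ite_eq', Finset.mem_univ, if_true]
    simp only [Fin.sum_univ_three]
    ring
  simp only [hsum]
  rw [integral_finsetSum _ fun j _ => (hD j).continuousOn.integrableOn_compact isCompact_refCube]
  simp [key]

/-! ### Green's formula on an element -/

/-- The value of the affine vector field `x ↦ p + G x`. -/
def affineField (p : R3) (G : Mat) (x : R3) : R3 := p + G *ᵥ x

/-- The centre of a facet of the cube. -/
def facetCenter (k : Fin 3) (b : Bool) : R3 :=
  Function.update (fun _ => 1 / 2) k (side b)

namespace Element

variable (E : Element)

theorem partialDeriv_comp_map {φ : R3 → ℝ} (hφ : Differentiable ℝ φ) (j : Fin 3) (x : R3) :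
    partialDeriv j (φ ∘ E.map) x = ∑ i, partialDeriv i φ (E.map x) * E.DF i j := by
  have h := ((hφ (E.map x)).hasFDerivAt.comp x (E.hasFDerivAt_map x)).fderiv
  unfold partialDeriv
  rw [h, ContinuousLinearMap.comp_apply]
  have : (Matrix.toLin' E.DF).toContinuousLinearMap (Pi.single j 1) =
      ∑ i, E.DF i j • (Pi.single i 1 : R3) := by
    ext i
    simp [Finset.sum_apply, Pi.single_apply]
  rw [this, map_sum]
  simp [mul_comm]

/-- The reference stress with the affine flux `p + G x` through the facet `(k, b)` of the element,
and without flux through the other facets. -/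
def fluxStress (k : Fin 3) (b : Bool) (p : R3) (G : Mat) : R3 → Mat := fun x r =>
  fluxField k b (affineField p G (E.map (facetCenter k b)) r)
    (Function.update (fun l => (G * E.DF) r l) k 0) x

theorem isRefStress_fluxStress (k : Fin 3) (b : Bool) (p : R3) (G : Mat) :
    IsRefStress (E.fluxStress k b p G) :=
  fun _ => fluxField_mem_ERT0 k b _ (by simp)

/-- Explains the parameters of `fluxStress`: an affine field pulled back to a reference facet is its
value at the centre plus the rows of G DF applied to the displacement from the centre, and this
displacement has no k-th coordinate. -/
theorem affineField_map_update (k : Fin 3) (b : Bool) (p : R3) (G : Mat) (x : R3) (r : Fin 3) :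
    affineField p G (E.map (facetCenter k b)) r +
      ∑ l, Function.update (fun l => (G * E.DF) r l) k 0 l * (x l - 1 / 2) =
    affineField p G (E.map (Function.update x k (side b))) r := by
  have h : affineField p G (E.map (Function.update x k (side b))) -
      affineField p G (E.map (facetCenter k b)) =
      (G * E.DF) *ᵥ (Function.update x k (side b) - facetCenter k b) := by
    rw [← Matrix.mulVec_mulVec, ← E.map_add_sub, Matrix.mulVec_sub, affineField, affineField]
    exact add_sub_add_left_eq_sub _ _ _
  have h' := congrFun h r
  rw [Pi.sub_apply, sub_eq_iff_eq_add'] at h'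
  rw [h', add_right_inj, Matrix.mulVec, dotProduct]
  refine Finset.sum_congr rfl fun l _ => ?_
  rcases eq_or_ne l k with rfl | hl
  · simp [facetCenter]
  · simp [facetCenter, hl]

theorem piola_apply (τ : R3 → Mat) (x : R3) (r i : Fin 3) :
    E.piola τ x r i = 1 / E.J * ∑ j, τ (E.invMap x) r j * E.DF i j := by
  simp [piola, Matrix.mul_apply]

/-- The divergence of the stress `fluxStress`. -/
def fluxDiv (k : Fin 3) (b : Bool) (p : R3) (G : Mat) : R3 :=
  (1 / E.J) • affineField p G (E.map (facetCenter k b))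

/-- The Piola transform preserves fluxes: its factor 1 / J cancels the Jacobian of the volume
integral, and its factor DFᵀ is the one that the chain rule produces for ∇(φ ∘ F). The facet
integral therefore keeps the reference measure, with no area factor. -/
theorem green (k : Fin 3) (b : Bool) (p : R3) (G : Mat) (r : Fin 3) {φ : R3 → ℝ}
    (hφ : ContDiff ℝ ∞ φ) :
    ∫ x in E.carrier, ((∑ i, E.piola (E.fluxStress k b p G) x r i * partialDeriv i φ x) +
        E.fluxDiv k b p G r * φ x) =
      ∫ x in refCube, affineField p G (E.map (Function.update x k (side b))) r *
        φ (E.map (Function.update x k (side b))) := by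
  have hψ : ContDiff ℝ ∞ (φ ∘ E.map) := hφ.comp E.contDiff_map
  have hg := green_refCube (k := k) b (affineField p G (E.map (facetCenter k b)) r)
    (β := Function.update (fun l => (G * E.DF) r l) k 0) (by simp) hψ
  simp only [affineField_map_update] at hg
  rw [E.setIntegral_carrier, ← integral_const_mul]
  refine Eq.trans ?_ hg
  refine setIntegral_congr_fun measurableSet_refCube fun x _ => ?_
  have hJ := E.J_pos.ne'
  simp only [piola_apply, invMap_map, E.partialDeriv_comp_map (hφ.differentiable (by simp)),
    fluxDiv, Pi.smul_apply, smul_eq_mul, Function.comp_apply]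
  rw [mul_add]
  congr 1
  · simp only [Finset.mul_sum, Finset.sum_mul]
    rw [Finset.sum_comm]
    refine Finset.sum_congr rfl fun j _ => Finset.sum_congr rfl fun i _ => ?_
    unfold fluxStress
    field_simp
  · field_simp

end Element

/-! ### Integrals over facets -/

theorem side_mem (b : Bool) : 0 ≤ side b ∧ side b ≤ 1 := by
  cases b <;> simp [side]

theorem update_mem_refCube {x : R3} (hx : x ∈ refCube) (k : Fin 3) {t : ℝ}
    (ht : 0 ≤ t ∧ t ≤ 1) : Function.update x k t ∈ refCube := by
  intro i
  rcases eq_or_ne i k with rfl | h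
  · simpa using ht
  · simpa [h] using hx i

namespace Element

theorem mem_facet_iff (E : Element) {k : Fin 3} {b : Bool} {z : R3} :
    z ∈ E.facet k b ↔ ∃ y ∈ refCube, y k = side b ∧ E.map y = z := by
  unfold facet face
  rw [Set.mem_image]
  refine exists_congr fun y => ?_
  rw [← and_assoc]
  refine and_congr_left fun _ => ⟨fun h => ⟨fun i => ⟨(h i).1, (h i).2.1⟩, ?_⟩, fun h i => ?_⟩
  · cases b
    · simpa [side] using (h k).2.2.1
    · simpa [side] using (h k).2.2.2
  · refine ⟨(h.1 i).1, (h.1 i).2, fun hi => ?_, fun hi => ?_⟩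
    all_goals
      rcases eq_or_ne i k with rfl | hik
      · simp only [Function.update_self, Option.some.injEq] at hi
        simpa [side, hi] using h.2
      · simp [hik] at hi

theorem map_update_mem_facet (E : Element) {x : R3} (hx : x ∈ refCube) (k : Fin 3) (b : Bool) :
    E.map (Function.update x k (side b)) ∈ E.facet k b :=
  E.mem_facet_iff.2 ⟨_, update_mem_refCube hx k (side_mem b), by simp, rfl⟩

/-- An affine map of `ℝ³` that identifies the facets `(k, b)` and `(k', b')` of the cube in the
coordinates of the elements `E` and `E'`, if both are the same facet in physical space. -/
def facetMap (E E' : Element) (k k' : Fin 3) (b : Bool) (x : R3) : R3 :=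
  Function.update (E'.invMap (E.map (Function.update x k (side b)))) k' (x k)

/-- The linear part of `facetMap`. -/
def facetLin (E E' : Element) (k k' : Fin 3) : R3 →ₗ[ℝ] R3 where
  toFun v := Function.update (E'.DF⁻¹ *ᵥ (E.DF *ᵥ Function.update v k 0)) k' (v k)
  map_add' v w := by
    rw [← Function.update_add, ← Matrix.mulVec_add, ← Matrix.mulVec_add, ← Function.update_add,
      add_zero, Pi.add_apply]
  map_smul' c v := by
    rw [RingHom.id_apply, ← Function.update_smul, ← Matrix.mulVec_smul, ← Matrix.mulVec_smul,
      ← Function.update_smul, smul_zero, Pi.smul_apply]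

theorem facetMap_sub (E E' : Element) (k k' : Fin 3) (b : Bool) (x y : R3) :
    facetMap E E' k k' b x - facetMap E E' k k' b y = facetLin E E' k k' (x - y) := by
  simp only [facetMap, facetLin, LinearMap.coe_mk, AddHom.coe_mk]
  rw [← Function.update_sub, invMap, invMap, ← Matrix.mulVec_sub, sub_sub_sub_cancel_right,
    map_add_sub, ← Function.update_sub, sub_self, Pi.sub_apply]

theorem hasFDerivAt_facetMap (E E' : Element) (k k' : Fin 3) (b : Bool) (x : R3) :
    HasFDerivAt (facetMap E E' k k' b) (facetLin E E' k k').toContinuousLinearMap x := by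
  have h := ((facetLin E E' k k').toContinuousLinearMap.hasFDerivAt (x := x)).const_add
    (facetMap E E' k k' b 0)
  refine h.congr_of_eventuallyEq (.of_forall fun y => ?_)
  have := facetMap_sub E E' k k' b y 0
  rw [sub_zero, sub_eq_iff_eq_add'] at this
  exact this

variable {E E' : Element} {k k' : Fin 3} {b b' : Bool}

theorem facetMap_spec (h : E.facet k b = E'.facet k' b') {x : R3} (hx : x ∈ refCube) :
    facetMap E E' k k' b x ∈ refCube ∧
      E'.map (Function.update (facetMap E E' k k' b x) k' (side b')) =
        E.map (Function.update x k (side b)) := by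
  have h1 := E.map_update_mem_facet hx k b
  rw [h] at h1
  obtain ⟨y, hy, hyk, hyx⟩ := E'.mem_facet_iff.1 h1
  have h2 : E'.invMap (E.map (Function.update x k (side b))) = y := by
    rw [← hyx, invMap_map]
  refine ⟨?_, ?_⟩
  · rw [facetMap, h2]
    exact update_mem_refCube hy k' (hx k)
  · rw [facetMap, h2, Function.update_idem, ← hyk, Function.update_eq_self, hyx]

theorem facetMap_facetMap (h : E.facet k b = E'.facet k' b') {x : R3} (hx : x ∈ refCube) :
    facetMap E' E k' k b' (facetMap E E' k k' b x) = x := by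
  rw [facetMap, (facetMap_spec h hx).2, invMap_map, Function.update_idem]
  simp [facetMap]

/-- Both sides are averages over the same parallelogram, so they do not depend on the
parametrisation. The change of variables is `facetMap`, which also carries the frozen coordinate
along and so is an affine bijection of the whole cube. -/
theorem setIntegral_facet_eq (h : E.facet k b = E'.facet k' b') (g : R3 → ℝ) :
    ∫ x in refCube, g (E.map (Function.update x k (side b))) =
      ∫ x in refCube, g (E'.map (Function.update x k' (side b'))) := by
  have hinj : Set.InjOn (facetMap E E' k k' b) refCube :=
    Set.LeftInvOn.injOn (f₁' := facetMap E' E k' k b') fun x hx => facetMap_facetMap h hx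
  have himg : facetMap E E' k k' b '' refCube = refCube := by
    refine Set.Subset.antisymm (Set.image_subset_iff.2 fun x hx => (facetMap_spec h hx).1)
      fun x hx => ⟨_, (facetMap_spec h.symm hx).1, facetMap_facetMap h.symm hx⟩
  have hcv := integral_image_eq_integral_abs_det_fderiv_smul volume measurableSet_refCube
    (fun x _ => (hasFDerivAt_facetMap E E' k k' b x).hasFDerivWithinAt) hinj (F := ℝ)
  rw [himg] at hcv
  -- An affine bijection of a set of volume one has Jacobian of absolute value one; the change of
  -- variables for the constant function 1 says so.
  have hdet := hcv fun _ => 1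
  simp only [integral_const, measureReal_def, Measure.restrict_apply_univ, volume_refCube,
    smul_eq_mul, ENNReal.toReal_one, mul_one, one_mul] at hdet
  rw [hcv fun x => g (E'.map (Function.update x k' (side b'))), ← hdet]
  refine setIntegral_congr_fun measurableSet_refCube fun x hx => ?_
  simp only [(facetMap_spec h hx).2, one_smul]

/-- A skew-symmetric matrix that vanishes on a plane spanned by two edges is zero. -/
theorem eq_zero_of_skew (E : Element) {G : Mat} (hG : Gᵀ = -G) {k : Fin 3}
    (h : ∀ l, l ≠ k → G *ᵥ (E.DF *ᵥ Pi.single l 1) = 0) : G = 0 := by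
  -- The congruent matrix is again skew, and in the edge basis the hypothesis says that all its
  -- columns but the k-th vanish. Skewness then removes the k-th column as well.
  let S : Mat := E.DFᵀ * G * E.DF
  have hS : Sᵀ = -S := by
    simp only [S, Matrix.transpose_mul, Matrix.transpose_transpose, hG]
    simp [Matrix.mul_assoc]
  have hS' : ∀ i j, S j i = - S i j := fun i j => congrFun (congrFun hS i) j
  have hcol : ∀ l, l ≠ k → ∀ i, S i l = 0 := by
    intro l hl i
    have : S *ᵥ Pi.single l 1 = 0 := by
      simp only [S, ← Matrix.mulVec_mulVec, h l hl, Matrix.mulVec_zero]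
    simpa using congrFun this i
  have hS0 : S = 0 := by
    ext i j
    by_cases hj : j = k
    · by_cases hi : i = k
      · rw [hi, hj]
        have := hS' k k
        simpa using self_eq_neg.1 this
      · rw [hS' j i, hcol i hi]
        simp
    · exact hcol j hj i
  have hu := E.isUnit_det
  have hut : IsUnit E.DFᵀ.det := by rwa [Matrix.det_transpose]
  calc G = E.DFᵀ⁻¹ * S * E.DF⁻¹ := by
        simp only [S]
        rw [Matrix.mul_assoc E.DFᵀ, Matrix.nonsing_inv_mul_cancel_left _ _ hut,
          Matrix.mul_nonsing_inv_cancel_right _ _ hu]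
    _ = 0 := by simp [hS0]

/-- A rigid motion that vanishes on a facet is zero: the differences of its values along the two
edges of the facet at a vertex show that the skew part kills a plane, and the value at that vertex
then gives the constant part. -/
theorem affineField_eq_zero (E : Element) {p : R3} {G : Mat} (hG : Gᵀ = -G) {k : Fin 3} {b : Bool}
    (h : ∀ x ∈ E.facet k b, affineField p G x = 0) : p = 0 ∧ G = 0 := by
  have h0 : (0 : R3) ∈ refCube := fun i => by simp
  have h1 : ∀ l, (Pi.single l 1 : R3) ∈ refCube := fun l => by
    simpa [Pi.single] using update_mem_refCube h0 l (t := 1) (by simp)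
  have e0 := h _ (E.map_update_mem_facet h0 k b)
  have hG0 : G = 0 := by
    refine E.eq_zero_of_skew hG (k := k) fun l hl => ?_
    have e1 := h _ (E.map_update_mem_facet (h1 l) k b)
    have e2 : G *ᵥ (E.map (Function.update (Pi.single l 1) k (side b)) -
        E.map (Function.update 0 k (side b))) = 0 := by
      rw [Matrix.mulVec_sub, ← add_sub_add_left_eq_sub _ _ p]
      unfold affineField at e0 e1
      rw [e0, e1, sub_zero]
    rw [map_add_sub, ← Function.update_sub, sub_zero, sub_self] at e2
    rwa [Function.update_eq_self_iff.2 (by simp [hl.symm])] at e2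
  subst hG0
  exact ⟨by simpa [affineField] using e0, rfl⟩

theorem exists_affineSubspace_of_face (E : Element) {s : Fin 3 → Option Bool} {k l : Fin 3}
    (hkl : k ≠ l) (hk : s k ≠ none) (hl : s l ≠ none) :
    ∃ A : AffineSubspace ℝ R3, Module.finrank ℝ A.direction ≤ 1 ∧ E.face s ⊆ A := by
  let x₀ : R3 := fun i => if s i = some true then 1 else 0
  let D : Submodule ℝ R3 := LinearMap.ker (LinearMap.proj k : R3 →ₗ[ℝ] ℝ) ⊓
    LinearMap.ker (LinearMap.proj l : R3 →ₗ[ℝ] ℝ)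
  have hx₀ : ∀ i, s i ≠ none → ∀ x ∈ refFace s, x i = x₀ i := by
    intro i hi x hx
    obtain ⟨b, hb⟩ := Option.ne_none_iff_exists'.1 hi
    cases b
    · simpa [x₀, hb] using (hx i).2.2.1
    · simpa [x₀, hb] using (hx i).2.2.2
  have hD : Module.finrank ℝ D ≤ 1 := by
    obtain ⟨m, hm⟩ : ∃ m, ∀ i, i = k ∨ i = l ∨ i = m := by
      clear D hx₀ x₀ hk hl
      decide +revert
    let f : D →ₗ[ℝ] ℝ := (LinearMap.proj m : R3 →ₗ[ℝ] ℝ).comp D.subtype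
    have hf : Function.Injective f := by
      refine (injective_iff_map_eq_zero f).2 fun v hv => Subtype.ext (funext fun i => ?_)
      rcases hm i with rfl | rfl | rfl
      · exact v.2.1
      · exact v.2.2
      · exact hv
    simpa using LinearMap.finrank_le_finrank_of_injective hf
  refine ⟨AffineSubspace.mk' (E.map x₀) (D.map (Matrix.toLin' E.DF)), ?_, ?_⟩
  · rw [AffineSubspace.direction_mk']
    exact (Submodule.finrank_map_le _ _).trans hD
  · rintro _ ⟨x, hx, rfl⟩
    rw [SetLike.mem_coe, AffineSubspace.mem_mk', vsub_eq_sub, map_add_sub]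
    refine ⟨x - x₀, ⟨?_, ?_⟩, rfl⟩
    · simp [hx₀ k hk x hx]
    · simp [hx₀ l hl x hx]

end Element

/-! ### Connectedness of the partition through facets -/

theorem volume_affineSpan_insert (A : AffineSubspace ℝ R3)
    (hA : Module.finrank ℝ A.direction ≤ 1) (x : R3) :
    volume (affineSpan ℝ (insert x (A : Set R3)) : Set R3) = 0 := by
  refine Measure.addHaar_affineSubspace volume _ fun h => ?_
  have h1 := finrank_vectorSpan_insert_le A x
  rw [← direction_affineSpan, h, AffineSubspace.direction_top, finrank_top] at h1
  simp only [Module.finrank_fin_fun] at h1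
  omega

/-- Lines do not separate a convex open set in ℝ³. A segment from x that leaves K must cross K ∩ L,
hence one of the lines, so its endpoint lies in the span of x and that line. These finitely many
spans are null, so the open set B \ K is null and thus empty. -/
theorem subset_of_inter_subset_affineSubspaces {κ : Type*} [Finite κ] {A : κ → AffineSubspace ℝ R3}
    (hA : ∀ j, Module.finrank ℝ (A j).direction ≤ 1) {K L B : Set R3} (hK : IsClosed K)
    (hL : IsClosed L) (hB : Convex ℝ B) (hBo : IsOpen B) (hcov : B ⊆ K ∪ L)
    (hKL : K ∩ L ⊆ ⋃ j, (A j : Set R3)) {x : R3} (hx : x ∈ B) (hxK : x ∈ K)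
    (hxA : x ∉ ⋃ j, (A j : Set R3)) : B ⊆ K := by
  let N := ⋃ j, (affineSpan ℝ (insert x (A j : Set R3)) : Set R3)
  have hN : volume N = 0 := measure_iUnion_null fun j => volume_affineSpan_insert _ (hA j) x
  have key : B \ N ⊆ K := by
    rintro z ⟨hz, hzN⟩
    by_contra hzK
    have hseg : segment ℝ x z ⊆ B := hB.segment_subset hx hz
    obtain ⟨p, hp, hpKL⟩ := isPreconnected_closed_iff.1 (convex_segment x z).isPreconnected K L hK hL
      (hseg.trans hcov) ⟨x, left_mem_segment ℝ x z, hxK⟩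
      ⟨z, right_mem_segment ℝ x z, (hcov hz).resolve_left hzK⟩
    obtain ⟨j, hj⟩ := Set.mem_iUnion.1 (hKL hpKL)
    rw [segment_eq_image_lineMap] at hp
    obtain ⟨t, -, rfl⟩ := hp
    have ht : t ≠ 0 := by
      rintro rfl
      rw [AffineMap.lineMap_apply_zero] at hj
      exact hxA (Set.mem_iUnion.2 ⟨j, hj⟩)
    refine hzN (Set.mem_iUnion.2 ⟨j, ?_⟩)
    have h1 : x ∈ affineSpan ℝ (insert x (A j : Set R3)) :=
      subset_affineSpan ℝ _ (Set.mem_insert _ _)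
    have h2 : AffineMap.lineMap x z t ∈ affineSpan ℝ (insert x (A j : Set R3)) :=
      subset_affineSpan ℝ _ (Set.mem_insert_of_mem _ hj)
    have h3 := AffineMap.lineMap_mem t⁻¹ h1 h2
    -- The crossing point is different from x, so z is recovered as a point on the line from x
    -- through it, and this line lies in the span.
    have h4 : AffineMap.lineMap x (AffineMap.lineMap x z t) t⁻¹ = z := by
      simp [AffineMap.lineMap_apply, smul_smul, ht]
    rwa [h4] at h3
  have hopen : IsOpen (B \ K) := hBo.sdiff hK
  have hnull : volume (B \ K) = 0 :=
    measure_mono_null (fun z hz => by_contra fun hzN => hz.2 (key ⟨hz.1, hzN⟩)) hN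
  exact Set.sdiff_eq_empty.1 ((hopen.measure_eq_zero_iff volume).1 hnull)

theorem exists_notMem_affineSubspaces {κ : Type*} [Finite κ] {A : κ → AffineSubspace ℝ R3}
    (hA : ∀ j, Module.finrank ℝ (A j).direction ≤ 1) {B : Set R3} (hBo : IsOpen B)
    (hB : B.Nonempty) : ∃ x ∈ B, x ∉ ⋃ j, (A j : Set R3) := by
  by_contra! h
  have hN : volume (⋃ j, (A j : Set R3)) = 0 := measure_iUnion_null fun j =>
    measure_mono_null ((Set.subset_insert 0 _).trans (subset_affineSpan ℝ _))
      (volume_affineSpan_insert _ (hA j) 0)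
  exact hB.ne_empty ((hBo.measure_eq_zero_iff volume).1 (measure_mono_null h hN))

/-- By the previous argument in small balls, each point of Ω is interior to K or to L. A point
interior to both would give an open subset of a finite union of lines, so two nonempty parts would
split the connected set Ω. -/
theorem not_nonempty_of_inter_subset_affineSubspaces {κ : Type*} [Finite κ]
    {A : κ → AffineSubspace ℝ R3} (hA : ∀ j, Module.finrank ℝ (A j).direction ≤ 1)
    {K L Ω : Set R3} (hK : IsClosed K) (hL : IsClosed L) (hΩ : IsOpen Ω) (hΩc : IsPreconnected Ω)
    (hcov : Ω ⊆ K ∪ L) (hKL : K ∩ L ⊆ ⋃ j, (A j : Set R3))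
    (hKΩ : (Ω ∩ interior K).Nonempty) : ¬ (Ω ∩ interior L).Nonempty := by
  intro hLΩ
  have hsub : Ω ⊆ interior K ∪ interior L := by
    intro p hp
    obtain ⟨r, hr, hball⟩ := Metric.isOpen_iff.1 hΩ p hp
    obtain ⟨x, hx, hxA⟩ := exists_notMem_affineSubspaces hA Metric.isOpen_ball
      (Metric.nonempty_ball.2 hr : (Metric.ball p r).Nonempty)
    rcases hcov (hball hx) with hxK | hxL
    · exact Or.inl (interior_maximal (subset_of_inter_subset_affineSubspaces hA hK hL
        (convex_ball p r) Metric.isOpen_ball (hball.trans hcov) hKL hx hxK hxA)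
        Metric.isOpen_ball (Metric.mem_ball_self hr))
    · exact Or.inr (interior_maximal (subset_of_inter_subset_affineSubspaces hA hL hK
        (convex_ball p r) Metric.isOpen_ball ((hball.trans hcov).trans (Set.union_comm K L).subset)
        ((Set.inter_comm L K).subset.trans hKL) hx hxL hxA)
        Metric.isOpen_ball (Metric.mem_ball_self hr))
  obtain ⟨p, hp, hpK, hpL⟩ := hΩc _ _ isOpen_interior isOpen_interior hsub hKΩ hLΩ
  obtain ⟨x, hx, hxA⟩ := exists_notMem_affineSubspaces hA
    (isOpen_interior.inter isOpen_interior) ⟨p, hpK, hpL⟩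
  exact hxA (hKL ⟨interior_subset hx.1, interior_subset hx.2⟩)

/-- The intersection is a face of both elements. Unless it is a full facet for both, one of the two
descriptions fixes two coordinates of the cube, which leaves at most a line. -/
theorem IsPartition.exists_affineSubspace {ι : Type*} {Ω : Set R3} {T : ι → Element}
    (hT : IsPartition Ω T) {i j : ι} (hij : i ≠ j)
    (h : ∀ k b k' b', (T i).carrier ∩ (T j).carrier = (T i).facet k b →
      (T i).facet k b ≠ (T j).facet k' b') :
    ∃ A : AffineSubspace ℝ R3, Module.finrank ℝ A.direction ≤ 1 ∧
      (T i).carrier ∩ (T j).carrier ⊆ A := by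
  rcases hT.conforming i j hij with hd | ⟨s, t, ⟨k, hk⟩, hs, ht⟩
  · exact ⟨⊥, by rw [AffineSubspace.direction_bot, finrank_bot]; exact zero_le_one,
      by simp [hd.inter_eq]⟩
  by_cases hs2 : ∃ l, k ≠ l ∧ s l ≠ none
  · obtain ⟨l, hkl, hl⟩ := hs2
    rw [hs]
    exact (T i).exists_affineSubspace_of_face hkl hk hl
  have facet_of : ∀ (s : Fin 3 → Option Bool) (k : Fin 3), s k ≠ none →
      (¬ ∃ l, k ≠ l ∧ s l ≠ none) → ∃ b, s = Function.update (fun _ => none) k (some b) := by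
    intro s k hk hs
    obtain ⟨b, hb⟩ := Option.ne_none_iff_exists'.1 hk
    refine ⟨b, funext fun l => ?_⟩
    rcases eq_or_ne l k with rfl | hl
    · simpa using hb
    · rw [Function.update_of_ne hl]
      by_contra hne
      exact hs ⟨l, hl.symm, hne⟩
  by_cases ht1 : ∃ k', t k' ≠ none
  · obtain ⟨k', hk'⟩ := ht1
    by_cases ht2 : ∃ l, k' ≠ l ∧ t l ≠ none
    · obtain ⟨l, hkl, hl⟩ := ht2
      rw [ht]
      exact (T j).exists_affineSubspace_of_face hkl hk' hl
    obtain ⟨b, rfl⟩ := facet_of s k hk hs2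
    obtain ⟨b', rfl⟩ := facet_of t k' hk' ht2
    exact absurd (hs.symm.trans ht) (h k b k' b' hs)
  · push Not at ht1
    -- If t fixes no coordinate, the face of the second element is the whole element; then it would
    -- lie in a null set.
    have : (T j).carrier ⊆ (T i).carrier ∩ (T j).carrier := by
      rw [ht]
      exact Set.image_mono fun x hx i => ⟨(hx i).1, (hx i).2, by simp [ht1], by simp [ht1]⟩
    have h0 : volume (interior (T j).carrier) = 0 :=
      measure_mono_null (_root_.interior_subset.trans this) (hT.volume_inter hij)
    exact absurd ((isOpen_interior.measure_eq_zero_iff volume).1 h0)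
      (T j).nonempty_interior.ne_empty

/-- In a partition of a connected open set, any two elements are linked by a chain of elements
such that consecutive elements share a facet. -/
theorem IsPartition.forall_of_facet_adjacent {ι : Type*} [Finite ι] {Ω : Set R3} {T : ι → Element}
    (hT : IsPartition Ω T) (hΩ : IsOpen Ω) (hreg : interior (closure Ω) = Ω)
    (hc : IsPreconnected Ω) {P : ι → Prop}
    (hP : ∀ i j k b k' b', i ≠ j → (T i).facet k b = (T j).facet k' b' → P i → P j)
    (hex : ∃ i, P i) (j : ι) : P j := by
  classical
  by_contra hj
  obtain ⟨i, hi⟩ := hex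
  -- Pairs of elements that do not go from P to its complement play no role in the separation and
  -- receive the empty subspace.
  have hA : ∀ q : ι × ι, ∃ A : AffineSubspace ℝ R3, Module.finrank ℝ A.direction ≤ 1 ∧
      (P q.1 → ¬ P q.2 → (T q.1).carrier ∩ (T q.2).carrier ⊆ A) := by
    intro q
    by_cases hq : P q.1 ∧ ¬ P q.2
    · have hne : q.1 ≠ q.2 := fun h => hq.2 (h ▸ hq.1)
      obtain ⟨A, hA, hsub⟩ := hT.exists_affineSubspace hne fun k b k' b' _ h =>
        hq.2 (hP _ _ k b k' b' hne h hq.1)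
      exact ⟨A, hA, fun _ _ => hsub⟩
    · exact ⟨⊥, by rw [AffineSubspace.direction_bot, finrank_bot]; exact zero_le_one,
        fun h1 h2 => absurd ⟨h1, h2⟩ hq⟩
  choose A hA1 hA2 using hA
  have hclosed : ∀ Q : Set ι, IsClosed (⋃ i ∈ Q, (T i).carrier) := fun Q =>
    Q.toFinite.isClosed_biUnion fun i _ => (T i).isClosed_carrier
  have hne : ∀ (Q : Set ι) (i : ι), i ∈ Q → (Ω ∩ interior (⋃ i ∈ Q, (T i).carrier)).Nonempty := by
    intro Q i hi
    obtain ⟨x, hx⟩ := (T i).nonempty_interior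
    exact ⟨x, hT.interior_subset hreg i hx,
      interior_mono (Set.subset_biUnion_of_mem (u := fun i => (T i).carrier) hi) hx⟩
  refine not_nonempty_of_inter_subset_affineSubspaces hA1 (hclosed {i | P i}) (hclosed {i | ¬ P i})
    hΩ hc ?_ ?_ (hne _ i hi) (hne _ j hj)
  · intro x hx
    have := subset_closure hx
    rw [hT.cover] at this
    obtain ⟨m, hm⟩ := Set.mem_iUnion.1 this
    by_cases hPm : P m
    · exact Or.inl (Set.mem_biUnion (show m ∈ {i | P i} from hPm) hm)
    · exact Or.inr (Set.mem_biUnion (show m ∈ {i | ¬ P i} from hPm) hm)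
  · rintro x ⟨hx1, hx2⟩
    obtain ⟨m, hm, hxm⟩ := Set.mem_iUnion₂.1 hx1
    obtain ⟨n, hn, hxn⟩ := Set.mem_iUnion₂.1 hx2
    exact Set.mem_iUnion.2 ⟨(m, n), hA2 (m, n) hm hn ⟨hxm, hxn⟩⟩

/-! ### The weak divergence -/

section WeakDiv

variable {Ω ΓD : Set R3}

theorem IsL2.integrable_mul {g h : R3 → ℝ} (hg : IsL2 Ω g) (hh : IsL2 Ω h) :
    Integrable (fun x => g x * h x) (volume.restrict Ω) :=
  MemLp.integrable_mul hg hh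

theorem isL2_of_hasCompactSupport {φ : R3 → ℝ} (hφ : Continuous φ) (hc : HasCompactSupport φ) :
    IsL2 Ω φ :=
  (hφ.memLp_of_hasCompactSupport hc).restrict Ω

theorem hasCompactSupport_partialDeriv {φ : R3 → ℝ} (hc : HasCompactSupport φ) (j : Fin 3) :
    HasCompactSupport (partialDeriv j φ) :=
  (hc.fderiv (𝕜 := ℝ)).comp_left (g := fun L : R3 →L[ℝ] ℝ => L (Pi.single j 1)) rfl

theorem isL2_partialDeriv {φ : R3 → ℝ} (hφ : ContDiff ℝ ∞ φ) (hc : HasCompactSupport φ)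
    (j : Fin 3) : IsL2 Ω (partialDeriv j φ) :=
  isL2_of_hasCompactSupport (continuous_partialDeriv hφ j) (hasCompactSupport_partialDeriv hc j)

theorem integrable_sum_mul_partialDeriv {q : R3 → R3} (hq : ∀ j, IsL2 Ω fun x => q x j)
    {φ : R3 → ℝ} (hφ : ContDiff ℝ ∞ φ) (hc : HasCompactSupport φ) :
    Integrable (fun x => ∑ j, q x j * partialDeriv j φ x) (volume.restrict Ω) :=
  integrable_finsetSum _ fun j _ => (hq j).integrable_mul (isL2_partialDeriv hφ hc j)

theorem hasWeakDiv_congr {q q' : R3 → R3} (h : q =ᵐ[volume.restrict Ω] q') :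
    HasWeakDiv Ω q = HasWeakDiv Ω q' := by
  have key : ∀ φ : R3 → ℝ, ∫ x in Ω, ∑ j, q x j * partialDeriv j φ x =
      ∫ x in Ω, ∑ j, q' x j * partialDeriv j φ x := fun φ =>
    integral_congr_ae (h.mono fun x hx => by simp only [hx])
  ext g
  simp only [HasWeakDiv, key]

theorem weakDiv_congr {q q' : R3 → R3} (h : q =ᵐ[volume.restrict Ω] q') :
    weakDiv Ω q = weakDiv Ω q' := by
  unfold weakDiv
  rw [hasWeakDiv_congr h]

theorem isHDiv_congr {q q' : R3 → R3} (h : q =ᵐ[volume.restrict Ω] q') (hq : IsHDiv Ω q) :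
    IsHDiv Ω q' := by
  refine ⟨fun j => (hq.1 j).ae_eq (h.mono fun x hx => by simp only [hx]), ?_⟩
  rw [← hasWeakDiv_congr h]
  exact hq.2

theorem hasZeroNormalTraceOff_congr {q q' : R3 → R3} (h : q =ᵐ[volume.restrict Ω] q')
    (hq : HasZeroNormalTraceOff Ω ΓD q) : HasZeroNormalTraceOff Ω ΓD q' := by
  intro φ hφ hc hd
  rw [← hq φ hφ hc hd, weakDiv_congr h]
  exact integral_congr_ae (h.mono fun x hx => by simp only [hx])

theorem isL2_weakDiv {q : R3 → R3} (hq : IsHDiv Ω q) : IsL2 Ω (weakDiv Ω q) := by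
  unfold weakDiv
  rw [dif_pos hq.2]
  exact hq.2.choose_spec.1

theorem hasWeakDiv_weakDiv {q : R3 → R3} (hq : IsHDiv Ω q) : HasWeakDiv Ω q (weakDiv Ω q) := by
  unfold weakDiv
  rw [dif_pos hq.2]
  exact hq.2.choose_spec.2

/-- The fundamental lemma of the calculus of variations. It makes the divergence chosen in `weakDiv`
interchangeable with any explicit one. -/
theorem HasWeakDiv.ae_eq (hΩ : IsOpen Ω) (hb : Bornology.IsBounded Ω) {q : R3 → R3}
    {g h : R3 → ℝ} (hg : IsL2 Ω g) (hh : IsL2 Ω h) (hqg : HasWeakDiv Ω q g)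
    (hqh : HasWeakDiv Ω q h) : g =ᵐ[volume.restrict Ω] h := by
  have : IsFiniteMeasure (volume.restrict Ω) :=
    ⟨by rw [Measure.restrict_apply_univ]; exact hb.measure_lt_top⟩
  have hint : IntegrableOn (g - h) Ω := (MemLp.sub hg hh).integrable one_le_two
  have key := hΩ.ae_eq_zero_of_integral_contDiff_smul_eq_zero (μ := volume)
    hint.locallyIntegrableOn fun φ hφ hc hs => by
      have h1 := hqg φ hφ hc hs
      rw [hqh φ hφ hc hs, neg_inj] at h1
      have hφL : IsL2 Ω φ := isL2_of_hasCompactSupport hφ.continuous hc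
      have h2 : ∫ x in Ω, φ x • (g - h) x = 0 := by
        simp only [Pi.sub_apply, smul_eq_mul, mul_comm (φ _), sub_mul]
        rw [integral_sub (hg.integrable_mul hφL) (hh.integrable_mul hφL), h1, sub_self]
      rw [← h2]
      refine (setIntegral_eq_integral_of_forall_compl_eq_zero fun x hx => ?_).symm
      rw [image_eq_zero_of_notMem_tsupport fun h => hx (hs h), zero_smul]
  filter_upwards [(ae_restrict_iff' hΩ.measurableSet).2 key] with x hx
  exact sub_eq_zero.1 hx

theorem HasWeakDiv.weakDiv_ae_eq (hΩ : IsOpen Ω) (hb : Bornology.IsBounded Ω) {q : R3 → R3}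
    {g : R3 → ℝ} (hq : ∀ j, IsL2 Ω fun x => q x j) (hg : IsL2 Ω g) (h : HasWeakDiv Ω q g) :
    weakDiv Ω q =ᵐ[volume.restrict Ω] g :=
  have hd : IsHDiv Ω q := ⟨hq, g, hg, h⟩
  (hasWeakDiv_weakDiv hd).ae_eq hΩ hb (isL2_weakDiv hd) hg h

theorem HasWeakDiv.add {q q' : R3 → R3} {g g' : R3 → ℝ} (hq : ∀ j, IsL2 Ω fun x => q x j)
    (hq' : ∀ j, IsL2 Ω fun x => q' x j) (hg : IsL2 Ω g) (hg' : IsL2 Ω g')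
    (h : HasWeakDiv Ω q g) (h' : HasWeakDiv Ω q' g') : HasWeakDiv Ω (q + q') (g + g') := by
  intro φ hφ hc hs
  have hφL : IsL2 Ω φ := isL2_of_hasCompactSupport hφ.continuous hc
  simp only [Pi.add_apply, add_mul, Finset.sum_add_distrib]
  rw [integral_add (integrable_sum_mul_partialDeriv hq hφ hc)
    (integrable_sum_mul_partialDeriv hq' hφ hc), integral_add (hg.integrable_mul hφL)
    (hg'.integrable_mul hφL), h φ hφ hc hs, h' φ hφ hc hs, neg_add]

theorem HasWeakDiv.smul (c : ℝ) {q : R3 → R3} {g : R3 → ℝ} (h : HasWeakDiv Ω q g) :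
    HasWeakDiv Ω (c • q) (c • g) := by
  intro φ hφ hc hs
  simp only [Pi.smul_apply, smul_eq_mul, mul_assoc, ← Finset.mul_sum]
  rw [integral_const_mul, integral_const_mul, h φ hφ hc hs, mul_neg]

theorem IsL2.add {g h : R3 → ℝ} (hg : IsL2 Ω g) (hh : IsL2 Ω h) : IsL2 Ω (g + h) :=
  MemLp.add hg hh

theorem IsL2.smul (c : ℝ) {g : R3 → ℝ} (hg : IsL2 Ω g) : IsL2 Ω (c • g) :=
  MemLp.const_smul hg c

theorem IsHDiv.add {q q' : R3 → R3} (hq : IsHDiv Ω q) (hq' : IsHDiv Ω q') :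
    IsHDiv Ω (q + q') :=
  ⟨fun j => (hq.1 j).add (hq'.1 j), _, (isL2_weakDiv hq).add (isL2_weakDiv hq'),
    (hasWeakDiv_weakDiv hq).add hq.1 hq'.1 (isL2_weakDiv hq) (isL2_weakDiv hq')
      (hasWeakDiv_weakDiv hq')⟩

theorem IsHDiv.smul (c : ℝ) {q : R3 → R3} (hq : IsHDiv Ω q) : IsHDiv Ω (c • q) :=
  ⟨fun j => (hq.1 j).smul c, _, (isL2_weakDiv hq).smul c, (hasWeakDiv_weakDiv hq).smul c⟩

theorem weakDiv_add (hΩ : IsOpen Ω) (hb : Bornology.IsBounded Ω) {q q' : R3 → R3}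
    (hq : IsHDiv Ω q) (hq' : IsHDiv Ω q') :
    weakDiv Ω (q + q') =ᵐ[volume.restrict Ω] weakDiv Ω q + weakDiv Ω q' :=
  HasWeakDiv.weakDiv_ae_eq hΩ hb (hq.add hq').1 ((isL2_weakDiv hq).add (isL2_weakDiv hq'))
    ((hasWeakDiv_weakDiv hq).add hq.1 hq'.1 (isL2_weakDiv hq) (isL2_weakDiv hq')
      (hasWeakDiv_weakDiv hq'))

theorem weakDiv_smul (hΩ : IsOpen Ω) (hb : Bornology.IsBounded Ω) (c : ℝ) {q : R3 → R3}
    (hq : IsHDiv Ω q) : weakDiv Ω (c • q) =ᵐ[volume.restrict Ω] c • weakDiv Ω q :=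
  HasWeakDiv.weakDiv_ae_eq hΩ hb (hq.smul c).1 ((isL2_weakDiv hq).smul c)
    ((hasWeakDiv_weakDiv hq).smul c)

theorem hasZeroNormalTraceOff_iff (hΩ : IsOpen Ω) (hb : Bornology.IsBounded Ω) {q : R3 → R3}
    {g : R3 → ℝ} (hq : ∀ j, IsL2 Ω fun x => q x j) (hg : IsL2 Ω g) (h : HasWeakDiv Ω q g) :
    HasZeroNormalTraceOff Ω ΓD q ↔ ∀ φ : R3 → ℝ, ContDiff ℝ ∞ φ → HasCompactSupport φ →
      Disjoint (tsupport φ) ΓD →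
      ∫ x in Ω, ((∑ j, q x j * partialDeriv j φ x) + g x * φ x) = 0 := by
  refine forall_congr' fun φ => forall₃_congr fun hφ hc hd => ?_
  rw [integral_congr_ae ((h.weakDiv_ae_eq hΩ hb hq hg).mono fun x hx => ?_)]
  simp only [hx]

theorem integral_green_add {q q' : R3 → R3} {g g' φ : R3 → ℝ}
    (hq : ∀ j, IsL2 Ω fun x => q x j) (hq' : ∀ j, IsL2 Ω fun x => q' x j) (hg : IsL2 Ω g)
    (hg' : IsL2 Ω g') (hφ : ContDiff ℝ ∞ φ) (hc : HasCompactSupport φ) :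
    ∫ x in Ω, ((∑ j, (q + q') x j * partialDeriv j φ x) + (g + g') x * φ x) =
      (∫ x in Ω, ((∑ j, q x j * partialDeriv j φ x) + g x * φ x)) +
      ∫ x in Ω, ((∑ j, q' x j * partialDeriv j φ x) + g' x * φ x) := by
  have hφL : IsL2 Ω φ := isL2_of_hasCompactSupport hφ.continuous hc
  refine Eq.trans ?_ (integral_add
    ((integrable_sum_mul_partialDeriv hq hφ hc).add (hg.integrable_mul hφL))
    ((integrable_sum_mul_partialDeriv hq' hφ hc).add (hg'.integrable_mul hφL)))
  congr 1
  ext x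
  simp only [Pi.add_apply, add_mul, Finset.sum_add_distrib]
  ring

theorem HasZeroNormalTraceOff.add (hΩ : IsOpen Ω) (hb : Bornology.IsBounded Ω) {q q' : R3 → R3}
    (hq : IsHDiv Ω q) (hq' : IsHDiv Ω q') (h : HasZeroNormalTraceOff Ω ΓD q)
    (h' : HasZeroNormalTraceOff Ω ΓD q') : HasZeroNormalTraceOff Ω ΓD (q + q') := by
  rw [hasZeroNormalTraceOff_iff hΩ hb (hq.add hq').1 ((isL2_weakDiv hq).add (isL2_weakDiv hq'))
    ((hasWeakDiv_weakDiv hq).add hq.1 hq'.1 (isL2_weakDiv hq) (isL2_weakDiv hq')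
      (hasWeakDiv_weakDiv hq'))]
  intro φ hφ hc hd
  rw [integral_green_add hq.1 hq'.1 (isL2_weakDiv hq) (isL2_weakDiv hq') hφ hc, h φ hφ hc hd,
    h' φ hφ hc hd, add_zero]

theorem HasZeroNormalTraceOff.smul (hΩ : IsOpen Ω) (hb : Bornology.IsBounded Ω) (c : ℝ)
    {q : R3 → R3} (hq : IsHDiv Ω q) (h : HasZeroNormalTraceOff Ω ΓD q) :
    HasZeroNormalTraceOff Ω ΓD (c • q) := by
  rw [hasZeroNormalTraceOff_iff hΩ hb (hq.smul c).1 ((isL2_weakDiv hq).smul c)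
    ((hasWeakDiv_weakDiv hq).smul c)]
  intro φ hφ hc hd
  have := congrArg (c * ·) (h φ hφ hc hd)
  simp only [mul_zero] at this
  rw [← this, ← integral_const_mul]
  congr 1
  ext x
  simp only [Pi.smul_apply, smul_eq_mul, mul_add, Finset.mul_sum, mul_assoc]

theorem isHDiv_zero : IsHDiv Ω 0 :=
  ⟨fun _ => MemLp.zero', 0, MemLp.zero', fun φ _ _ _ => by simp⟩

theorem IsStress.add (hΩ : IsOpen Ω) (hb : Bornology.IsBounded Ω) {σ τ : R3 → Mat}
    (hσ : IsStress Ω ΓD σ) (hτ : IsStress Ω ΓD τ) : IsStress Ω ΓD (σ + τ) := fun i =>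
  ⟨(hσ i).1.add (hτ i).1, (hσ i).2.add hΩ hb (hσ i).1 (hτ i).1 (hτ i).2⟩

theorem IsStress.smul (hΩ : IsOpen Ω) (hb : Bornology.IsBounded Ω) (c : ℝ) {τ : R3 → Mat}
    (hτ : IsStress Ω ΓD τ) : IsStress Ω ΓD (c • τ) := fun i =>
  ⟨(hτ i).1.smul c, (hτ i).2.smul hΩ hb c (hτ i).1⟩

theorem isStress_zero (hΩ : IsOpen Ω) (hb : Bornology.IsBounded Ω) :
    IsStress Ω ΓD (0 : R3 → Mat) := fun _ =>
  ⟨isHDiv_zero, (hasZeroNormalTraceOff_iff hΩ hb (g := 0) (fun _ => MemLp.zero') MemLp.zero'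
    fun φ _ _ _ => by simp).2 fun φ _ _ _ => by simp⟩

theorem row_ae_eq {σ τ : R3 → Mat} (h : σ =ᵐ[volume.restrict Ω] τ) (i : Fin 3) :
    (fun x => σ x i) =ᵐ[volume.restrict Ω] fun x => τ x i :=
  h.mono fun x hx => by simp only [hx]

theorem IsStress.congr {σ τ : R3 → Mat} (h : σ =ᵐ[volume.restrict Ω] τ)
    (hσ : IsStress Ω ΓD σ) : IsStress Ω ΓD τ := fun i =>
  ⟨isHDiv_congr (row_ae_eq h i) (hσ i).1, hasZeroNormalTraceOff_congr (row_ae_eq h i) (hσ i).2⟩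

theorem matDiv_congr {σ τ : R3 → Mat} (h : σ =ᵐ[volume.restrict Ω] τ) :
    matDiv Ω σ = matDiv Ω τ := by
  ext x i
  simp only [matDiv, weakDiv_congr (row_ae_eq h i)]

end WeakDiv

/-! ### Stresses with a prescribed flux through a facet -/

theorem IsRefStress.continuous {τ : R3 → Mat} (h : IsRefStress τ) : Continuous τ :=
  continuous_pi fun i => continuous_of_mem_ERT0 (h i)

theorem Element.continuous_piola (E : Element) {τ : R3 → Mat} (h : Continuous τ) :
    Continuous (E.piola τ) := by
  have h1 : Continuous fun x => τ (E.invMap x) * E.DFᵀ :=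
    (h.comp E.continuous_invMap).matrix_mul continuous_const
  exact h1.const_smul (1 / E.J)

theorem continuous_affineField (p : R3) (G : Mat) : Continuous (affineField p G) :=
  continuous_const.add (Continuous.matrix_mulVec continuous_const continuous_id)

theorem contDiff_affineField (p : R3) (G : Mat) (r : Fin 3) :
    ContDiff ℝ ∞ fun x => affineField p G x r := by
  have h : ContDiff ℝ ∞ (Matrix.toLin' G).toContinuousLinearMap := ContinuousLinearMap.contDiff _
  exact contDiff_pi.1 (contDiff_const (c := p) |>.add h) r

theorem partialDeriv_affineField (p : R3) (G : Mat) (r j : Fin 3) (x : R3) :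
    partialDeriv j (fun x => affineField p G x r) x = G r j := by
  have h := ((hasFDerivAt_pi'.1 ((Matrix.toLin' G).toContinuousLinearMap.hasFDerivAt
    (x := x)) r).const_add (p r)).fderiv
  have h' : partialDeriv j (fun x => affineField p G x r) x =
      fderiv ℝ (fun x => p r + (Matrix.toLin' G).toContinuousLinearMap x r) x (Pi.single j 1) := rfl
  rw [h', h]
  simp

theorem affineField_sub (p p' : R3) (G G' : Mat) (x : R3) :
    affineField (p - p') (G - G') x = affineField p G x - affineField p' G' x := by
  simp only [affineField, Matrix.sub_mulVec]
  abel

theorem affineField_neg (p : R3) (G : Mat) (x : R3) :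
    affineField (-p) (-G) x = - affineField p G x := by
  simp only [affineField, Matrix.neg_mulVec, neg_add]

theorem affineField_zero (x : R3) : affineField 0 0 x = 0 := by
  simp [affineField]

namespace Element

variable (E : Element)

theorem integrableOn_carrier {g : R3 → ℝ} (hg : Continuous g) : IntegrableOn g E.carrier :=
  hg.continuousOn.integrableOn_compact E.isCompact_carrier

/-- The barycentre of an element. -/
def center : R3 := fun j => (volume.real E.carrier)⁻¹ * ∫ x in E.carrier, x j

theorem volume_real_carrier_pos : 0 < volume.real E.carrier := by
  refine ENNReal.toReal_pos (fun h => ?_) E.volume_carrier_lt_top.ne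
  have h0 := measure_mono_null _root_.interior_subset h
  exact E.nonempty_interior.ne_empty ((isOpen_interior.measure_eq_zero_iff volume).1 h0)

/-- The vector `u` minus the value of the linear field `γ` at the barycentre: the constant part of
the affine field with derivative `γ` and mean value `u`. -/
def affineConst (u : R3) (γ : Mat) : R3 := u - γ *ᵥ E.center

theorem setIntegral_affineField (u : R3) (γ : Mat) (r : Fin 3) :
    ∫ x in E.carrier, affineField (E.affineConst u γ) γ x r = volume.real E.carrier * u r := by
  have hc : ∀ j, Continuous fun x : R3 => x j := fun j => continuous_apply j
  have hv := E.volume_real_carrier_pos.ne'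
  simp only [affineField, Pi.add_apply, affineConst, Pi.sub_apply, Matrix.mulVec, dotProduct]
  rw [integral_add (E.integrableOn_carrier continuous_const)
    (E.integrableOn_carrier (by fun_prop)), setIntegral_const,
    integral_finsetSum _ fun j _ => E.integrableOn_carrier ((hc j).const_mul _)]
  simp only [integral_const_mul, smul_eq_mul, mul_sub, Finset.mul_sum, center]
  have : ∀ j, volume.real E.carrier * (γ r j * ((volume.real E.carrier)⁻¹ *
      ∫ x in E.carrier, x j)) = γ r j * ∫ x in E.carrier, x j := by
    intro j
    field_simp
  simp only [this, sub_add_cancel]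

/-- Green's formula tested with the components of the affine field with gradient γ and mean value u.
Since the divergence is constant on the element, only this mean enters the divergence term; what
remains is the flux integrated against the affine field. -/
theorem setIntegral_fluxStress (k : Fin 3) (b : Bool) (p : R3) (G : Mat) (u : R3) (γ : Mat) :
    (∫ _ in E.carrier, u ⬝ᵥ E.fluxDiv k b p G) +
      (∫ x in E.carrier, frob γ (E.piola (E.fluxStress k b p G) x)) =
    ∑ r, ∫ x in refCube, affineField p G (E.map (Function.update x k (side b))) r *
      affineField (E.affineConst u γ) γ (E.map (Function.update x k (side b))) r := by
  have hτ := E.continuous_piola (E.isRefStress_fluxStress k b p G).continuous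
  have hτ' : ∀ r j, Continuous fun x => E.piola (E.fluxStress k b p G) x r j := fun r j =>
    hτ.matrix_elem r j
  have hρ := fun r => (contDiff_affineField (E.affineConst u γ) γ r)
  simp only [← E.green k b p G _ (hρ _), partialDeriv_affineField]
  have h1 : ∀ r, ∫ x in E.carrier, ((∑ i, E.piola (E.fluxStress k b p G) x r i * γ r i) +
      E.fluxDiv k b p G r * affineField (E.affineConst u γ) γ x r) =
      (∫ x in E.carrier, ∑ i, E.piola (E.fluxStress k b p G) x r i * γ r i) +
        E.fluxDiv k b p G r * (volume.real E.carrier * u r) := by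
    intro r
    rw [integral_add (E.integrableOn_carrier (by fun_prop))
      (E.integrableOn_carrier ((hρ r).continuous.const_mul _)), integral_const_mul,
      E.setIntegral_affineField]
  simp only [h1, Finset.sum_add_distrib]
  rw [← integral_finsetSum _ fun r _ => E.integrableOn_carrier (by fun_prop), add_comm,
    setIntegral_const]
  congr 1
  · simp only [frob, mul_comm]
  · simp only [dotProduct, smul_eq_mul, Finset.mul_sum]
    exact Finset.sum_congr rfl fun r _ => by ring

/-- A sum of integrals of continuous squares is zero, so each square vanishes almost everywhere,
hence everywhere on the cube. -/
theorem affineField_eq_zero_of_setIntegral (k : Fin 3) (b : Bool) (p : R3) (G : Mat)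
    (h : ∑ r, ∫ x in refCube, affineField p G (E.map (Function.update x k (side b))) r *
      affineField p G (E.map (Function.update x k (side b))) r = 0) :
    ∀ x ∈ E.facet k b, affineField p G x = 0 := by
  have hu : Continuous fun x : R3 => Function.update x k (side b) :=
    continuous_id.update k continuous_const
  have hc : ∀ r, Continuous fun x =>
      affineField p G (E.map (Function.update x k (side b))) r := fun r =>
    (continuous_apply r).comp ((continuous_affineField p G).comp (E.continuous_map.comp hu))
  rw [Finset.sum_eq_zero_iff_of_nonneg fun r _ =>
    integral_nonneg fun _ => mul_self_nonneg _] at h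
  intro z hz
  obtain ⟨y, hy, hyk, rfl⟩ := E.mem_facet_iff.1 hz
  ext r
  have hr := (setIntegral_eq_zero_iff_of_nonneg_ae (.of_forall fun _ => mul_self_nonneg _)
    (((hc r).mul (hc r)).continuousOn.integrableOn_compact isCompact_refCube)).1
    (h r (Finset.mem_univ r))
  have hcl : refCube ⊆ closure (interior refCube) := by
    rw [convex_refCube.closure_interior_eq_closure_of_nonempty_interior nonempty_interior_refCube]
    exact subset_closure
  have := Measure.eqOn_of_ae_eq hr ((hc r).mul (hc r)).continuousOn continuousOn_const hcl hy
  simpa [← hyk, Function.update_eq_self] using this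

end Element

section Flux

variable {ι : Type*} [Fintype ι] {Ω ΓD : Set R3} {T : ι → Element}

/-- On every element a stress with a given affine flux through one of the facets. -/
def fluxGlue (T : ι → Element) (k : ι → Fin 3) (b : ι → Bool) (p : ι → R3) (G : ι → Mat) :
    R3 → Mat :=
  glue T fun i => (T i).piola ((T i).fluxStress (k i) (b i) (p i) (G i))

/-- The sum of the duality pairings of the fluxes of `fluxGlue` with a function `φ`. -/
def facetSum (T : ι → Element) (k : ι → Fin 3) (b : ι → Bool) (p : ι → R3) (G : ι → Mat)
    (r : Fin 3) (φ : R3 → ℝ) : ℝ :=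
  ∑ i, ∫ x in refCube,
    affineField (p i) (G i) ((T i).map (Function.update x (k i) (side (b i)))) r *
      φ ((T i).map (Function.update x (k i) (side (b i))))

variable {k : ι → Fin 3} {b : ι → Bool} {p : ι → R3} {G : ι → Mat}

theorem fluxGlue_ae_eq (hT : IsPartition Ω T) (i : ι) :
    fluxGlue T k b p G =ᵐ[volume.restrict (T i).carrier]
      (T i).piola ((T i).fluxStress (k i) (b i) (p i) (G i)) :=
  glue_ae_eq hT _ i

theorem green_fluxGlue (hT : IsPartition Ω T) (hreg : interior (closure Ω) = Ω) (r : Fin 3)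
    {φ : R3 → ℝ} (hφ : ContDiff ℝ ∞ φ) :
    ∫ x in Ω, ((∑ j, fluxGlue T k b p G x r j * partialDeriv j φ x) +
      glue T (fun i _ => (T i).fluxDiv (k i) (b i) (p i) (G i) r) x * φ x) =
      facetSum T k b p G r φ := by
  have hτ : ∀ i, ∀ j, Continuous fun x =>
      (T i).piola ((T i).fluxStress (k i) (b i) (p i) (G i)) x r j := fun i j =>
    ((T i).continuous_piola ((T i).isRefStress_fluxStress _ _ _ _).continuous).matrix_elem r j
  have hφ' := continuous_partialDeriv hφ
  have hφc := hφ.continuous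
  have hae : ∀ i, (fun x => (∑ j, fluxGlue T k b p G x r j * partialDeriv j φ x) +
      glue T (fun i _ => (T i).fluxDiv (k i) (b i) (p i) (G i) r) x * φ x)
      =ᵐ[volume.restrict (T i).carrier] fun x =>
      (∑ j, (T i).piola ((T i).fluxStress (k i) (b i) (p i) (G i)) x r j * partialDeriv j φ x) +
        (T i).fluxDiv (k i) (b i) (p i) (G i) r * φ x := by
    intro i
    filter_upwards [fluxGlue_ae_eq (k := k) (b := b) (p := p) (G := G) hT i,
      glue_ae_eq hT (fun i _ => (T i).fluxDiv (k i) (b i) (p i) (G i) r) i] with x h1 h2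
    simp only [h1, h2]
  rw [hT.setIntegral_eq_sum hreg]
  · refine Finset.sum_congr rfl fun i _ => ?_
    rw [integral_congr_ae (hae i), Element.green _ _ _ _ _ _ hφ]
  · intro i
    refine Integrable.congr ?_ (hae i).symm
    have hs : Continuous fun x => ∑ j,
        (T i).piola ((T i).fluxStress (k i) (b i) (p i) (G i)) x r j * partialDeriv j φ x :=
      continuous_finsetSum _ fun j _ => (hτ i j).mul (hφ' j)
    exact (T i).integrableOn_carrier (hs.add (hφc.const_mul _))

theorem isL2_fluxGlue (hT : IsPartition Ω T) (hreg : interior (closure Ω) = Ω) (r j : Fin 3) :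
    IsL2 Ω fun x => fluxGlue T k b p G x r j :=
  isL2_of_ae_eq_continuous hT hreg
    (fun i => ((T i).continuous_piola
      ((T i).isRefStress_fluxStress (k i) (b i) (p i) (G i)).continuous).matrix_elem r j)
    fun i => (fluxGlue_ae_eq (k := k) (b := b) (p := p) (G := G) hT i).mono
      fun x hx => by simp only [hx]

theorem isL2_glue_const (hT : IsPartition Ω T) (hreg : interior (closure Ω) = Ω) (c : ι → ℝ) :
    IsL2 Ω (glue T fun i _ => c i) :=
  isL2_of_ae_eq_continuous hT hreg (fun _ => continuous_const) fun i => glue_ae_eq hT _ i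

theorem hasWeakDiv_fluxGlue (hT : IsPartition Ω T) (hreg : interior (closure Ω) = Ω) (r : Fin 3)
    (h : ∀ φ : R3 → ℝ, (∀ x ∉ Ω, φ x = 0) → facetSum T k b p G r φ = 0) :
    HasWeakDiv Ω (fun x => fluxGlue T k b p G x r)
      (glue T fun i _ => (T i).fluxDiv (k i) (b i) (p i) (G i) r) := by
  intro φ hφ hc hs
  have h0 := h φ fun x hx => image_eq_zero_of_notMem_tsupport fun hx' => hx (hs hx')
  rw [← green_fluxGlue hT hreg r hφ, integral_add
    (integrable_sum_mul_partialDeriv (fun j => isL2_fluxGlue hT hreg r j) hφ hc)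
    ((isL2_glue_const hT hreg _).integrable_mul
      (isL2_of_hasCompactSupport hφ.continuous hc))] at h0
  exact eq_neg_of_add_eq_zero_left h0

/-- The facet sum is the total flux tested with φ. Its vanishing for φ that are zero off Ω says that
no singular divergence sits on the interfaces; its vanishing for φ that are zero on ΓD is the
condition on the normal trace. -/
theorem isDiscreteStress_fluxGlue (hΩ : IsOpen Ω) (hb : Bornology.IsBounded Ω)
    (hT : IsPartition Ω T) (hreg : interior (closure Ω) = Ω)
    (h : ∀ r, ∀ φ : R3 → ℝ, (∀ x ∉ Ω, φ x = 0) ∨ (∀ x ∈ ΓD, φ x = 0) →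
      facetSum T k b p G r φ = 0) : IsDiscreteStress Ω ΓD T (fluxGlue T k b p G) := by
  refine ⟨fun r => ?_, fun i => ⟨_, (T i).isRefStress_fluxStress _ _ _ _, fluxGlue_ae_eq hT i⟩⟩
  have hd := hasWeakDiv_fluxGlue hT hreg r fun φ hφ => h r φ (Or.inl hφ)
  have hq := fun j => isL2_fluxGlue (k := k) (b := b) (p := p) (G := G) hT hreg r j
  refine ⟨⟨hq, _, isL2_glue_const hT hreg _, hd⟩, ?_⟩
  rw [hasZeroNormalTraceOff_iff hΩ hb hq (isL2_glue_const hT hreg _) hd]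
  intro φ hφ hc hdis
  rw [green_fluxGlue hT hreg r hφ]
  exact h r φ (Or.inr fun x hx => image_eq_zero_of_notMem_tsupport fun hx' =>
    Set.disjoint_left.1 hdis hx' hx)

/-- The identity `setIntegral_fluxStress` summed over the elements. The hypothesis on facet sums
identifies the weak divergence on Ω with the elementwise one. -/
theorem pairing_fluxGlue (hΩ : IsOpen Ω) (hb : Bornology.IsBounded Ω)
    (hT : IsPartition Ω T) (hreg : interior (closure Ω) = Ω)
    (h : ∀ r, ∀ φ : R3 → ℝ, (∀ x ∉ Ω, φ x = 0) → facetSum T k b p G r φ = 0)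
    (u : ι → R3) (γ : ι → Mat) :
    (∫ x in Ω, glue T (fun i _ => u i) x ⬝ᵥ matDiv Ω (fluxGlue T k b p G) x) +
      (∫ x in Ω, frob (glue T (fun i _ => γ i) x) (fluxGlue T k b p G x)) =
    ∑ i, ∑ r, ∫ x in refCube,
      affineField (p i) (G i) ((T i).map (Function.update x (k i) (side (b i)))) r *
        affineField ((T i).affineConst (u i) (γ i)) (γ i)
          ((T i).map (Function.update x (k i) (side (b i)))) r := by
  have hdiv : ∀ i, ∀ᵐ x ∂volume.restrict (T i).carrier, ∀ r,
      matDiv Ω (fluxGlue T k b p G) x r = (T i).fluxDiv (k i) (b i) (p i) (G i) r := by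
    intro i
    refine ae_all_iff.2 fun r => ?_
    have h1 := (hasWeakDiv_fluxGlue hT hreg r (h r)).weakDiv_ae_eq hΩ hb
      (fun j => isL2_fluxGlue hT hreg r j) (isL2_glue_const hT hreg _)
    exact (ae_eq_carrier_of_ae_eq hT hreg h1 i).trans (glue_ae_eq hT _ i)
  have hae1 : ∀ i, (fun x => glue T (fun i _ => u i) x ⬝ᵥ matDiv Ω (fluxGlue T k b p G) x)
      =ᵐ[volume.restrict (T i).carrier] fun _ =>
        u i ⬝ᵥ (T i).fluxDiv (k i) (b i) (p i) (G i) := by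
    intro i
    filter_upwards [hdiv i, glue_ae_eq hT (fun i _ => u i) i] with x h1 h2
    simp only [h2, funext h1]
  have hae2 : ∀ i, (fun x => frob (glue T (fun i _ => γ i) x) (fluxGlue T k b p G x))
      =ᵐ[volume.restrict (T i).carrier] fun x =>
        frob (γ i) ((T i).piola ((T i).fluxStress (k i) (b i) (p i) (G i)) x) := by
    intro i
    filter_upwards [fluxGlue_ae_eq (k := k) (b := b) (p := p) (G := G) hT i,
      glue_ae_eq hT (fun i _ => γ i) i] with x h1 h2
    simp only [h1, h2]
  rw [hT.setIntegral_eq_sum hreg, hT.setIntegral_eq_sum hreg, ← Finset.sum_add_distrib]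
  · refine Finset.sum_congr rfl fun i _ => ?_
    rw [integral_congr_ae (hae1 i), integral_congr_ae (hae2 i), Element.setIntegral_fluxStress]
  · intro i
    refine Integrable.congr ?_ (hae2 i).symm
    refine (T i).integrableOn_carrier ?_
    have hτ : ∀ r j, Continuous fun x =>
        (T i).piola ((T i).fluxStress (k i) (b i) (p i) (G i)) x r j := fun r j =>
      ((T i).continuous_piola ((T i).isRefStress_fluxStress _ _ _ _).continuous).matrix_elem r j
    unfold frob
    exact continuous_finsetSum _ fun r _ => continuous_finsetSum _ fun j _ =>
      (hτ r j).const_mul _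
  · intro i
    exact Integrable.congr ((T i).integrableOn_carrier continuous_const) (hae1 i).symm

/-! ### Injectivity of the divergence and asymmetry constraints -/

/-- The test stress lives on the two elements only, and its flux through their common facet is the
jump of the two rigid motions. Its pairing is the integral of the squared jump. -/
theorem eq_of_facet_eq (hΩ : IsOpen Ω) (hb : Bornology.IsBounded Ω) (hT : IsPartition Ω T)
    (hreg : interior (closure Ω) = Ω) {u : ι → R3} {γ : ι → Mat} (hγ : ∀ i, (γ i)ᵀ = -γ i)
    (h : ∀ τ, IsDiscreteStress Ω ΓD T τ →
      (∫ x in Ω, glue T (fun i _ => u i) x ⬝ᵥ matDiv Ω τ x) +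
        (∫ x in Ω, frob (glue T (fun i _ => γ i) x) (τ x)) = 0)
    {i j : ι} (hij : i ≠ j) {k k' : Fin 3} {b b' : Bool}
    (hf : (T i).facet k b = (T j).facet k' b') :
    (T i).affineConst (u i) (γ i) = (T j).affineConst (u j) (γ j) ∧ γ i = γ j := by
  classical
  set P := (T i).affineConst (u i) (γ i) with hP
  set Q := (T j).affineConst (u j) (γ j) with hQ
  let K : ι → Fin 3 := fun m => if m = i then k else k'
  let B : ι → Bool := fun m => if m = i then b else b'
  -- The flux is measured along the outward normal of each element, hence the opposite signs on `i`
  -- and `j`.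
  let p : ι → R3 := Pi.single i (P - Q) - Pi.single j (P - Q)
  let G : ι → Mat := Pi.single i (γ i - γ j) - Pi.single j (γ i - γ j)
  have hKi : K i = k := by simp [K]
  have hKj : K j = k' := by simp [K, hij.symm]
  have hBi : B i = b := by simp [B]
  have hBj : B j = b' := by simp [B, hij.symm]
  have hpi : p i = P - Q := by simp [p, hij]
  have hpj : p j = -(P - Q) := by simp [p, hij]
  have hGi : G i = γ i - γ j := by simp [G, hij]
  have hGj : G j = -(γ i - γ j) := by simp [G, hij]
  have hpm : ∀ m, m ≠ i ∧ m ≠ j → p m = 0 := fun m hm => by simp [p, hm.1, hm.2]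
  have hGm : ∀ m, m ≠ i ∧ m ≠ j → G m = 0 := fun m hm => by simp [G, hm.1, hm.2]
  have hsum : ∀ r φ, facetSum T K B p G r φ = 0 := by
    intro r φ
    unfold facetSum
    rw [Finset.sum_eq_add i j hij]
    · rw [hKi, hKj, hBi, hBj, hpi, hpj, hGi, hGj]
      simp only [affineField_neg, Pi.neg_apply, neg_mul, integral_neg]
      rw [Element.setIntegral_facet_eq hf
        fun x => affineField (P - Q) (γ i - γ j) x r * φ x, add_neg_cancel]
    · intro m _ hm
      simp [hpm m hm, hGm m hm, affineField_zero]
    · simp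
    · simp
  have hpair := h _ (isDiscreteStress_fluxGlue hΩ hb hT hreg fun r φ _ => hsum r φ)
  rw [pairing_fluxGlue hΩ hb hT hreg (fun r φ _ => hsum r φ), Finset.sum_eq_add i j hij] at hpair
  · rw [hKi, hKj, hBi, hBj, hpi, hpj, hGi, hGj, ← hP, ← hQ] at hpair
    simp only [affineField_neg, Pi.neg_apply, neg_mul, integral_neg] at hpair
    have hdiff : ∑ r, ∫ x in refCube,
        affineField (P - Q) (γ i - γ j) ((T i).map (Function.update x k (side b))) r *
          affineField (P - Q) (γ i - γ j) ((T i).map (Function.update x k (side b))) r = 0 := by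
      rw [← hpair, ← Finset.sum_add_distrib]
      refine Finset.sum_congr rfl fun r _ => ?_
      -- The contribution of `j` is moved to the parametrisation of the facet by `i`, where jump ·
      -- P-field minus jump · Q-field is the square of the jump.
      rw [← Element.setIntegral_facet_eq hf
        fun x => affineField (P - Q) (γ i - γ j) x r * affineField Q (γ j) x r,
        ← sub_eq_add_neg, ← integral_sub]
      · congr 1
        ext x
        rw [affineField_sub, Pi.sub_apply]
        ring
      all_goals
        refine ContinuousOn.integrableOn_compact isCompact_refCube (Continuous.continuousOn ?_)
        have hu : Continuous fun x : R3 => (T i).map (Function.update x k (side b)) :=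
          (T i).continuous_map.comp (continuous_id.update k continuous_const)
        exact ((continuous_apply r).comp ((continuous_affineField _ _).comp hu)).mul
          ((continuous_apply r).comp ((continuous_affineField _ _).comp hu))
    have hz := (T i).affineField_eq_zero_of_setIntegral k b _ _ hdiff
    have hskew : (γ i - γ j)ᵀ = -(γ i - γ j) := by
      rw [Matrix.transpose_sub, hγ, hγ]
      abel
    have := (T i).affineField_eq_zero hskew hz
    exact ⟨sub_eq_zero.1 this.1, sub_eq_zero.1 this.2⟩
  · intro m _ hm
    simp [hpm m hm, hGm m hm, affineField_zero]
  · simp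
  · simp

/-- Here the test stress is supported on one element, with the rigid motion itself as flux through
the facet. It is admissible because flux through ΓD is unrestricted. -/
theorem eq_zero_of_facet_subset (hΩ : IsOpen Ω) (hb : Bornology.IsBounded Ω)
    (hT : IsPartition Ω T) (hreg : interior (closure Ω) = Ω) {u : ι → R3} {γ : ι → Mat}
    (hγ : ∀ i, (γ i)ᵀ = -γ i)
    (h : ∀ τ, IsDiscreteStress Ω ΓD T τ →
      (∫ x in Ω, glue T (fun i _ => u i) x ⬝ᵥ matDiv Ω τ x) +
        (∫ x in Ω, frob (glue T (fun i _ => γ i) x) (τ x)) = 0)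
    {i : ι} {k : Fin 3} {b : Bool} (hf : (T i).facet k b ⊆ frontier Ω)
    (hfD : (T i).facet k b ⊆ ΓD) :
    (T i).affineConst (u i) (γ i) = 0 ∧ γ i = 0 := by
  classical
  set P := (T i).affineConst (u i) (γ i) with hP
  let p : ι → R3 := Pi.single i P
  let G : ι → Mat := Pi.single i (γ i)
  have hpi : p i = P := by simp [p]
  have hGi : G i = γ i := by simp [G]
  have hpm : ∀ m, m ≠ i → p m = 0 := fun m hm => by simp [p, hm]
  have hGm : ∀ m, m ≠ i → G m = 0 := fun m hm => by simp [G, hm]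
  have hsum : ∀ r φ, (∀ x ∉ Ω, φ x = 0) ∨ (∀ x ∈ ΓD, φ x = 0) →
      facetSum T (fun _ => k) (fun _ => b) p G r φ = 0 := by
    intro r φ hφ
    -- The facet is in the boundary of the open set Ω, so it lies outside Ω; it also lies in ΓD.
    -- Either kind of test function is zero there.
    have hφ0 : ∀ x ∈ (T i).facet k b, φ x = 0 := fun x hx => hφ.elim
      (fun h => h x fun hxΩ => (hΩ.frontier_eq ▸ hf hx).2 hxΩ) (fun h => h x (hfD hx))
    unfold facetSum
    rw [Finset.sum_eq_single i]
    · refine (setIntegral_congr_fun measurableSet_refCube fun x hx => ?_).trans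
        (integral_zero _ _)
      simp only [hφ0 _ ((T i).map_update_mem_facet hx k b), mul_zero]
    · intro m _ hm
      simp [hpm m hm, hGm m hm, affineField_zero]
    · simp
  have hpair := h _ (isDiscreteStress_fluxGlue hΩ hb hT hreg hsum)
  rw [pairing_fluxGlue hΩ hb hT hreg (fun r φ hφ => hsum r φ (Or.inl hφ)),
    Finset.sum_eq_single i] at hpair
  · rw [hpi, hGi, ← hP] at hpair
    exact (T i).affineField_eq_zero (hγ i)
      ((T i).affineField_eq_zero_of_setIntegral k b _ _ hpair)
  · intro m _ hm
    simp [hpm m hm, hGm m hm, affineField_zero]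
  · simp

/-- Injectivity of the constraints: the rigid motion is zero next to a facet of ΓD, and equality
across shared facets carries this to every element. A vanishing rigid motion has zero gradient γ and
zero mean u. -/
theorem eq_zero_of_pairing_eq_zero {ΓN : Set R3} (hΩ : IsOpen Ω) (hb : Bornology.IsBounded Ω)
    (hc : IsPreconnected Ω) (hT : IsPartition Ω T) (hreg : interior (closure Ω) = Ω)
    (hΓ : IsBoundarySplit Ω T ΓD ΓN) {u : ι → R3} {γ : ι → Mat} (hγ : ∀ i, (γ i)ᵀ = -γ i)
    (h : ∀ τ, IsDiscreteStress Ω ΓD T τ →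
      (∫ x in Ω, glue T (fun i _ => u i) x ⬝ᵥ matDiv Ω τ x) +
        (∫ x in Ω, frob (glue T (fun i _ => γ i) x) (τ x)) = 0) :
    u = 0 ∧ γ = 0 := by
  have hex : ∃ i, (T i).affineConst (u i) (γ i) = 0 ∧ γ i = 0 := by
    obtain ⟨FD, FN, -, hF, hD, -⟩ := hΓ.aligned
    obtain ⟨x, hx⟩ := hΓ.nonempty
    rw [hD] at hx
    obtain ⟨q, hq, -⟩ := Set.mem_iUnion₂.1 hx
    refine ⟨q.1, eq_zero_of_facet_subset hΩ hb hT hreg hγ h (k := q.2.1) (b := q.2.2) ?_ ?_⟩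
    · have : q ∈ FD ∪ FN := Or.inl hq
      rw [hF] at this
      exact this
    · rw [hD]
      exact Set.subset_biUnion_of_mem
        (u := fun p : ι × Fin 3 × Bool => (T p.1).facet p.2.1 p.2.2) hq
  have hall := hT.forall_of_facet_adjacent hΩ hreg hc
    (P := fun i => (T i).affineConst (u i) (γ i) = 0 ∧ γ i = 0)
    (fun i j k b k' b' hij hf hi => by
      obtain ⟨h1, h2⟩ := eq_of_facet_eq hΩ hb hT hreg hγ h hij hf
      exact ⟨h1 ▸ hi.1, h2 ▸ hi.2⟩) hex
  refine ⟨funext fun i => ?_, funext fun i => (hall i).2⟩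
  have := (hall i).1
  rw [Element.affineConst, (hall i).2, Matrix.zero_mulVec, sub_zero] at this
  exact this

end Flux

/-! ### Square saddle point systems -/

/-- Testing the first equation with s itself removes the constraint term, so s = 0 by definiteness,
and then m is orthogonal to the range of the constraint. -/
theorem eq_zero_of_saddle {S M : Type*} [AddCommGroup S] [Module ℝ S] [AddCommGroup M]
    [Module ℝ M] {a : S →ₗ[ℝ] S →ₗ[ℝ] ℝ} {b : S →ₗ[ℝ] M →ₗ[ℝ] ℝ}
    (ha : ∀ s, a s s = 0 → s = 0) (hb : ∀ m, (∀ s, b s m = 0) → m = 0) {s : S} {m : M}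
    (h1 : ∀ t, a s t + b t m = 0) (h2 : ∀ n, b s n = 0) : s = 0 ∧ m = 0 := by
  have hs : s = 0 := ha s (by simpa [h2 m] using h1 s)
  exact ⟨hs, hb m fun t => by simpa [hs] using h1 t⟩

theorem saddle_unique {S M : Type*} [AddCommGroup S] [Module ℝ S] [AddCommGroup M] [Module ℝ M]
    {a : S →ₗ[ℝ] S →ₗ[ℝ] ℝ} {b : S →ₗ[ℝ] M →ₗ[ℝ] ℝ} (ha : ∀ s, a s s = 0 → s = 0)
    (hb : ∀ m, (∀ s, b s m = 0) → m = 0) {F : M →ₗ[ℝ] ℝ} {s s' : S} {m m' : M}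
    (h : (∀ t, a s t + b t m = 0) ∧ ∀ n, b s n = F n)
    (h' : (∀ t, a s' t + b t m' = 0) ∧ ∀ n, b s' n = F n) : s = s' ∧ m = m' := by
  obtain ⟨hs, hm⟩ := eq_zero_of_saddle ha hb (s := s - s') (m := m - m')
    (fun t => by rw [map_sub, LinearMap.sub_apply, map_sub]; linarith [h.1 t, h'.1 t])
    (fun n => by rw [map_sub, LinearMap.sub_apply, h.2, h'.2, sub_self])
  exact ⟨sub_eq_zero.1 hs, sub_eq_zero.1 hm⟩

theorem exists_saddle {S M : Type*} [AddCommGroup S] [Module ℝ S] [AddCommGroup M] [Module ℝ M]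
    [FiniteDimensional ℝ S] [FiniteDimensional ℝ M] {a : S →ₗ[ℝ] S →ₗ[ℝ] ℝ}
    {b : S →ₗ[ℝ] M →ₗ[ℝ] ℝ} (ha : ∀ s, a s s = 0 → s = 0)
    (hb : ∀ m, (∀ s, b s m = 0) → m = 0) (F : M →ₗ[ℝ] ℝ) :
    ∃ s m, (∀ t, a s t + b t m = 0) ∧ ∀ n, b s n = F n := by
  let Φ : S × M →ₗ[ℝ] (S →ₗ[ℝ] ℝ) × (M →ₗ[ℝ] ℝ) :=
    LinearMap.prod (a.comp (LinearMap.fst ℝ S M) + b.flip.comp (LinearMap.snd ℝ S M))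
      (b.comp (LinearMap.fst ℝ S M))
  have hinj : Function.Injective Φ := by
    refine (injective_iff_map_eq_zero Φ).2 fun z hz => ?_
    have h1 : ∀ t, a z.1 t + b t z.2 = 0 := fun t =>
      LinearMap.congr_fun (congrArg Prod.fst hz) t
    have h2 : ∀ n, b z.1 n = 0 := fun n => LinearMap.congr_fun (congrArg Prod.snd hz) n
    exact Prod.ext_iff.2 (eq_zero_of_saddle ha hb h1 h2)
  have hdim : Module.finrank ℝ (S × M) =
      Module.finrank ℝ ((S →ₗ[ℝ] ℝ) × (M →ₗ[ℝ] ℝ)) := by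
    simp only [Module.finrank_prod, Module.finrank_linearMap, Module.finrank_self, mul_one]
  obtain ⟨⟨s, m⟩, h⟩ :=
    (LinearMap.injective_iff_surjective_of_finrank_eq_finrank hdim).1 hinj (0, F)
  exact ⟨s, m, fun t => LinearMap.congr_fun (congrArg Prod.fst h) t,
    fun n => LinearMap.congr_fun (congrArg Prod.snd h) n⟩

/-! ### The quadrature rule -/

theorem frob_comm (σ τ : Mat) : frob σ τ = frob τ σ := by
  simp only [frob, mul_comm]

theorem frob_add_left (σ σ' τ : Mat) : frob (σ + σ') τ = frob σ τ + frob σ' τ := by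
  simp only [frob, Matrix.add_apply, add_mul, Finset.sum_add_distrib]

theorem frob_smul_left (c : ℝ) (σ τ : Mat) : frob (c • σ) τ = c * frob σ τ := by
  simp only [frob, Matrix.smul_apply, smul_eq_mul, mul_assoc, Finset.mul_sum]

theorem frob_add_right (σ τ τ' : Mat) : frob σ (τ + τ') = frob σ τ + frob σ τ' := by
  rw [frob_comm, frob_add_left, frob_comm τ, frob_comm τ']

theorem frob_smul_right (c : ℝ) (σ τ : Mat) : frob σ (c • τ) = c * frob σ τ := by
  rw [frob_comm, frob_smul_left, frob_comm]

theorem frob_self_nonneg (τ : Mat) : 0 ≤ frob τ τ :=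
  Finset.sum_nonneg fun _ _ => Finset.sum_nonneg fun _ _ => mul_self_nonneg _

theorem eq_zero_of_frob_self {τ : Mat} (h : frob τ τ = 0) : τ = 0 := by
  have h1 := (Finset.sum_eq_zero_iff_of_nonneg fun i _ => Finset.sum_nonneg fun j _ =>
    mul_self_nonneg (τ i j)).1 h
  ext i j
  have h2 := (Finset.sum_eq_zero_iff_of_nonneg fun j _ =>
    mul_self_nonneg (τ i j)).1 (h1 i (Finset.mem_univ i))
  exact mul_self_eq_zero.1 (h2 j (Finset.mem_univ j))

theorem continuous_frob_left (τ : Mat) : Continuous fun σ : Mat => frob σ τ := by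
  unfold frob
  exact continuous_finsetSum _ fun i _ => continuous_finsetSum _ fun j _ =>
    (continuous_apply_apply i j).mul_const _

namespace Element

variable (E : Element)

theorem mul_transpose_injective : Function.Injective fun m : Mat => m * E.DFᵀ := by
  have hu : IsUnit E.DFᵀ.det := by rw [Matrix.det_transpose]; exact E.isUnit_det
  intro m m' h
  have := congrArg (· * E.DFᵀ⁻¹) h
  simpa only [Matrix.mul_nonsing_inv_cancel_right _ _ hu] using this

theorem eqOn_of_piola_ae_eq {τ τ' : R3 → Mat} (hτ : Continuous τ) (hτ' : Continuous τ')
    (h : E.piola τ =ᵐ[volume.restrict E.carrier] E.piola τ') : Set.EqOn τ τ' refCube := by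
  intro x hx
  have h1 := E.eqOn_of_ae_eq (E.continuous_piola hτ) (E.continuous_piola hτ') h
    (E.map_mem_carrier hx)
  simp only [piola, invMap_map] at h1
  exact E.mul_transpose_injective (smul_right_injective _ (one_div_pos.2 E.J_pos).ne' h1)

/-- Two continuous reference stresses with almost everywhere equal Piola transforms agree on the
closed cube, because a closed element is the closure of its interior. So the vertex values used by
the quadrature do not depend on the choice. -/
theorem refStress_eq {τ τ' : R3 → Mat} (hτ' : IsRefStress τ')
    (h : τ =ᵐ[volume.restrict E.carrier] E.piola τ') {x : R3} (hx : x ∈ refCube) :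
    E.refStress τ x = τ' x := by
  have hex : ∃ τ' : R3 → Mat, IsRefStress τ' ∧ τ =ᵐ[volume.restrict E.carrier] E.piola τ' :=
    ⟨τ', hτ', h⟩
  unfold refStress
  rw [dif_pos hex]
  exact E.eqOn_of_piola_ae_eq hex.choose_spec.1.continuous hτ'.continuous
    (hex.choose_spec.2.symm.trans h) hx

theorem quad_eq (A : R3 → Mat →ₗ[ℝ] Mat) {τ τ' χ χ' : R3 → Mat} (hτ' : IsRefStress τ')
    (hχ' : IsRefStress χ') (hτ : τ =ᵐ[volume.restrict E.carrier] E.piola τ')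
    (hχ : χ =ᵐ[volume.restrict E.carrier] E.piola χ') :
    E.quad A τ χ = 1 / 8 * ∑ s : Fin 3 → Bool,
      frob (E.traceTensor A (E.map (refVertex s)) ((1 / E.J) • (τ' (refVertex s) * E.DFᵀ)))
        (χ' (refVertex s) * E.DFᵀ) := by
  simp only [quad, E.refStress_eq hτ' hτ (refVertex_mem_refCube _),
    E.refStress_eq hχ' hχ (refVertex_mem_refCube _)]

end Element

/-- The traces are genuine limits from inside the element, given by the continuous extension. The
interior of the element lies in Ω, so the coercivity bound passes to the limit, with the same
constant. -/
theorem IsCompliance.exists_traceTensor {ι : Type*} {Ω : Set R3} {T : ι → Element}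
    {A : R3 → Mat →ₗ[ℝ] Mat} (hA : IsCompliance Ω T A) (hT : IsPartition Ω T)
    (hreg : interior (closure Ω) = Ω) (i : ι) :
    ∃ B : R3 → Mat →ₗ[ℝ] Mat, (∀ x ∈ (T i).carrier, ∀ m, (T i).traceTensor A x m = B x m) ∧
      ∃ α : ℝ, 0 < α ∧ ∀ x ∈ (T i).carrier, ∀ m, α * frob m m ≤ frob (B x m) m := by
  obtain ⟨B, hB, hAB⟩ := hA.continuous i
  have hlim : ∀ x ∈ (T i).carrier, ∀ m, Filter.Tendsto (fun y => A y m)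
      (𝓝[interior (T i).carrier] x) (𝓝 (B x m)) := by
    intro x hx m
    refine ((hB m x hx).mono_left (nhdsWithin_mono x interior_subset)).congr' ?_
    filter_upwards [self_mem_nhdsWithin] with y hy
    rw [hAB y hy]
  have hne : ∀ x ∈ (T i).carrier, (𝓝[interior (T i).carrier] x).NeBot := fun x hx =>
    mem_closure_iff_nhdsWithin_neBot.1 ((T i).closure_interior.ge hx)
  refine ⟨B, fun x hx m => ?_, ?_⟩
  · have := hne x hx
    exact (hlim x hx m).limUnder_eq
  · obtain ⟨α, hα, h⟩ := hA.pos_def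
    refine ⟨α, hα, fun x hx m => ?_⟩
    have := hne x hx
    refine ge_of_tendsto (((continuous_frob_left m).tendsto _).comp (hlim x hx m)) ?_
    filter_upwards [self_mem_nhdsWithin] with y hy
    exact h y (hT.interior_subset hreg i hy) m

/-! ### Coordinates in the discrete spaces -/

/-- The skew-symmetric matrices. -/
def skew : Submodule ℝ Mat where
  carrier := {m | mᵀ = -m}
  zero_mem' := by simp
  add_mem' {m n} hm hn := by
    simp only [Set.mem_ofPred_eq] at hm hn ⊢
    rw [Matrix.transpose_add, hm, hn, neg_add]
  smul_mem' c m hm := by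
    simp only [Set.mem_ofPred_eq] at hm ⊢
    rw [Matrix.transpose_smul, hm, smul_neg]

section Coordinates

variable {ι : Type*} [Fintype ι] {Ω ΓD : Set R3} {T : ι → Element}

/-- The reference stress with the rows `c`. -/
def coordField (c : Fin 3 → ERT0) : R3 → Mat := fun x => Matrix.of fun r => (c r).1 x

theorem isRefStress_coordField (c : Fin 3 → ERT0) : IsRefStress (coordField c) :=
  fun r => (c r).2

theorem Element.piola_add (E : Element) (σ τ : R3 → Mat) :
    E.piola (σ + τ) = E.piola σ + E.piola τ := by
  ext1 x
  simp only [piola, Pi.add_apply, Matrix.add_mul, smul_add]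

theorem Element.piola_smul (E : Element) (a : ℝ) (τ : R3 → Mat) :
    E.piola (a • τ) = a • E.piola τ := by
  ext1 x
  simp only [piola, Pi.smul_apply, Matrix.smul_mul, smul_comm a]

/-- The stress whose reference stress on the element `T i` has the rows `c i`. -/
def stressField (T : ι → Element) : (ι → Fin 3 → ERT0) →ₗ[ℝ] R3 → Mat where
  toFun c := glue T fun i => (T i).piola (coordField (c i))
  map_add' c d := by
    rw [← glue_add]
    congr 1
    ext1 i
    exact (T i).piola_add _ _
  map_smul' a c := by
    rw [RingHom.id_apply, ← glue_smul]
    congr 1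
    ext1 i
    exact (T i).piola_smul _ _

theorem stressField_ae_eq (hT : IsPartition Ω T) (c : ι → Fin 3 → ERT0) (i : ι) :
    stressField T c =ᵐ[volume.restrict (T i).carrier] (T i).piola (coordField (c i)) :=
  glue_ae_eq hT _ i

/-- The coordinates of the discrete stresses. -/
def stressSpace (ΓD : Set R3) (T : ι → Element) (hΩ : IsOpen Ω) (hb : Bornology.IsBounded Ω) :
    Submodule ℝ (ι → Fin 3 → ERT0) where
  carrier := {c | IsStress Ω ΓD (stressField T c)}
  zero_mem' := by
    simp only [Set.mem_ofPred_eq, map_zero]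
    exact isStress_zero hΩ hb
  add_mem' {c d} hc hd := by
    simp only [Set.mem_ofPred_eq, map_add] at hc hd ⊢
    exact hc.add hΩ hb hd
  smul_mem' a c hc := by
    simp only [Set.mem_ofPred_eq, map_smul] at hc ⊢
    exact hc.smul hΩ hb a

theorem isDiscreteStress_stressField (hT : IsPartition Ω T) {c : ι → Fin 3 → ERT0}
    (hc : IsStress Ω ΓD (stressField T c)) : IsDiscreteStress Ω ΓD T (stressField T c) :=
  ⟨hc, fun i => ⟨_, isRefStress_coordField (c i), stressField_ae_eq hT c i⟩⟩

theorem IsDiscreteStress.exists_coord (hΩ : IsOpen Ω) (hb : Bornology.IsBounded Ω)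
    (hT : IsPartition Ω T) (hreg : interior (closure Ω) = Ω) {τ : R3 → Mat}
    (hτ : IsDiscreteStress Ω ΓD T τ) :
    ∃ c : stressSpace ΓD T hΩ hb, τ =ᵐ[volume.restrict Ω] stressField T c.1 := by
  choose τ' hτ' hae using hτ.2
  have h : τ =ᵐ[volume.restrict Ω] stressField T fun i r => ⟨_, hτ' i r⟩ :=
    ae_eq_glue hT hreg hae
  exact ⟨⟨_, hτ.1.congr h⟩, h⟩

/-- The piecewise constant field with the value `c i` in the element `T i`. -/
def constField {M : Type*} [AddCommGroup M] [Module ℝ M] (T : ι → Element) :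
    (ι → M) →ₗ[ℝ] R3 → M where
  toFun c := glue T fun i _ => c i
  map_add' _ _ := glue_add _ _
  map_smul' _ _ := glue_smul _ _

theorem isL2_constField (hT : IsPartition Ω T) (hreg : interior (closure Ω) = Ω) (v : ι → R3)
    (r : Fin 3) : IsL2 Ω fun x => constField T v x r :=
  isL2_of_ae_eq_continuous hT hreg (g := fun i _ => v i r) (fun _ => continuous_const) fun i =>
    (glue_ae_eq hT (fun i _ => v i) i).mono fun _ hx => congrFun hx r

theorem isL2_constField_matrix (hT : IsPartition Ω T) (hreg : interior (closure Ω) = Ω)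
    (w : ι → Mat) (r j : Fin 3) : IsL2 Ω fun x => constField T w x r j :=
  isL2_of_ae_eq_continuous hT hreg (g := fun i _ => w i r j) (fun _ => continuous_const) fun i =>
    (glue_ae_eq hT (fun i _ => w i) i).mono fun _ hx => congrFun (congrFun hx r) j

theorem isDiscreteDisplacement_constField (hT : IsPartition Ω T)
    (hreg : interior (closure Ω) = Ω) (v : ι → R3) :
    IsDiscreteDisplacement Ω T (constField T v) :=
  ⟨isL2_constField hT hreg v, fun i => ⟨v i, glue_ae_eq hT _ i⟩⟩

theorem IsDiscreteDisplacement.exists_coord (hT : IsPartition Ω T)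
    (hreg : interior (closure Ω) = Ω) {v : R3 → R3} (hv : IsDiscreteDisplacement Ω T v) :
    ∃ c, v =ᵐ[volume.restrict Ω] constField T c := by
  choose c hc using hv.2
  exact ⟨c, ae_eq_glue hT hreg hc⟩

theorem isDiscreteRotation_constField (hT : IsPartition Ω T)
    (hreg : interior (closure Ω) = Ω) (w : ι → skew) :
    IsDiscreteRotation Ω T (constField T fun i => (w i).1) := by
  refine ⟨⟨isL2_constField_matrix hT hreg _, (hT.ae_iff hreg _).2 fun i => ?_⟩,
    fun i => ⟨(w i).1, (w i).2, glue_ae_eq hT _ i⟩⟩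
  filter_upwards [glue_ae_eq hT (fun i _ => (w i).1) i] with x hx
  have : constField T (fun i => (w i).1) x = (w i).1 := hx
  rw [this]
  exact (w i).2

theorem IsDiscreteRotation.exists_coord (hT : IsPartition Ω T)
    (hreg : interior (closure Ω) = Ω) {w : R3 → Mat} (hw : IsDiscreteRotation Ω T w) :
    ∃ c : ι → skew, w =ᵐ[volume.restrict Ω] constField T fun i => (c i).1 := by
  choose c hs hc using hw.2
  exact ⟨fun i => ⟨c i, hs i⟩, ae_eq_glue hT hreg hc⟩

theorem quad_congr (hT : IsPartition Ω T) (hreg : interior (closure Ω) = Ω)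
    (A : R3 → Mat →ₗ[ℝ] Mat) {c d : ι → Fin 3 → ERT0} {σ τ : R3 → Mat}
    (hσ : σ =ᵐ[volume.restrict Ω] stressField T c) (hτ : τ =ᵐ[volume.restrict Ω] stressField T d) :
    quad T A σ τ = quad T A (stressField T c) (stressField T d) := by
  refine Finset.sum_congr rfl fun i _ => ?_
  have hσi := (ae_eq_carrier_of_ae_eq hT hreg hσ i).trans (stressField_ae_eq hT c i)
  have hτi := (ae_eq_carrier_of_ae_eq hT hreg hτ i).trans (stressField_ae_eq hT d i)
  rw [(T i).quad_eq A (isRefStress_coordField (c i)) (isRefStress_coordField (d i)) hσi hτi,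
    (T i).quad_eq A (isRefStress_coordField (c i)) (isRefStress_coordField (d i))
      (stressField_ae_eq hT c i)
      (stressField_ae_eq hT d i)]

/-- All weights of the rule are positive and every vertex term is coercive. A zero energy therefore
makes the stress vanish at each vertex, and unisolvence finishes the proof. Definiteness holds for
all piecewise stresses, before continuity of the fluxes is imposed. -/
theorem exists_quadForm (hT : IsPartition Ω T) (hreg : interior (closure Ω) = Ω)
    {A : R3 → Mat →ₗ[ℝ] Mat} (hA : IsCompliance Ω T A) :
    ∃ a : (ι → Fin 3 → ERT0) →ₗ[ℝ] (ι → Fin 3 → ERT0) →ₗ[ℝ] ℝ,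
      (∀ c d, a c d = quad T A (stressField T c) (stressField T d)) ∧
      ∀ c, a c c = 0 → c = 0 := by
  choose B hB α hα hcoer using hA.exists_traceTensor hT hreg
  let m : ι → (Fin 3 → Bool) → (ι → Fin 3 → ERT0) → Mat := fun i s c =>
    coordField (c i) (refVertex s) * (T i).DFᵀ
  have m_add : ∀ i s c d, m i s (c + d) = m i s c + m i s d := fun i s c d =>
    Matrix.add_mul (coordField (c i) (refVertex s)) (coordField (d i) (refVertex s)) _
  have m_smul : ∀ i s (t : ℝ) c, m i s (t • c) = t • m i s c := fun i s t c =>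
    Matrix.smul_mul t (coordField (c i) (refVertex s)) _
  have hquad : ∀ c d, quad T A (stressField T c) (stressField T d) =
      ∑ i, 1 / 8 * ∑ s, 1 / (T i).J *
        frob (B i ((T i).map (refVertex s)) (m i s c)) (m i s d) := by
    intro c d
    refine Finset.sum_congr rfl fun i _ => ?_
    rw [(T i).quad_eq A (isRefStress_coordField (c i)) (isRefStress_coordField (d i))
      (stressField_ae_eq hT c i) (stressField_ae_eq hT d i)]
    congr 1
    refine Finset.sum_congr rfl fun s _ => ?_
    rw [hB i _ ((T i).map_mem_carrier (refVertex_mem_refCube s)), map_smul, frob_smul_left]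
  refine ⟨LinearMap.mk₂ ℝ (fun c d => quad T A (stressField T c) (stressField T d))
    ?_ ?_ ?_ ?_, fun _ _ => rfl, ?_⟩
  · intro c c' d
    simp only [hquad, m_add]
    simp only [map_add, frob_add_left, mul_add, Finset.sum_add_distrib]
  · intro t c d
    simp only [hquad, m_smul]
    simp only [map_smul, frob_smul_left, Finset.mul_sum, smul_eq_mul]
    exact Finset.sum_congr rfl fun i _ => Finset.sum_congr rfl fun s _ => by ring
  · intro c d d'
    simp only [hquad, m_add, frob_add_right, mul_add, Finset.sum_add_distrib]
  · intro t c d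
    simp only [hquad, m_smul, frob_smul_right, Finset.mul_sum, smul_eq_mul]
    exact Finset.sum_congr rfl fun i _ => Finset.sum_congr rfl fun s _ => by ring
  · intro c hc
    have hnonneg : ∀ i s, 0 ≤ 1 / (T i).J *
        frob (B i ((T i).map (refVertex s)) (m i s c)) (m i s c) := fun i s =>
      mul_nonneg (one_div_pos.2 (T i).J_pos).le ((mul_nonneg (hα i).le (frob_self_nonneg _)).trans
        (hcoer i _ ((T i).map_mem_carrier (refVertex_mem_refCube s)) _))
    rw [LinearMap.mk₂_apply, hquad, Finset.sum_eq_zero_iff_of_nonneg fun i _ =>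
      mul_nonneg (by norm_num) (Finset.sum_nonneg fun s _ => hnonneg i s)] at hc
    funext i
    have hi := (mul_eq_zero.1 (hc i (Finset.mem_univ i))).resolve_left (by norm_num)
    rw [Finset.sum_eq_zero_iff_of_nonneg fun s _ => hnonneg i s] at hi
    have hm : ∀ s, m i s c = 0 := by
      intro s
      have h0 := (mul_eq_zero.1 (hi s (Finset.mem_univ s))).resolve_left
        (one_div_pos.2 (T i).J_pos).ne'
      have h1 := hcoer i _ ((T i).map_mem_carrier (refVertex_mem_refCube s)) (m i s c)
      rw [h0] at h1
      exact eq_zero_of_frob_self (le_antisymm (nonpos_of_mul_nonpos_right h1 (hα i))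
        (frob_self_nonneg _))
    have hv : ∀ s, coordField (c i) (refVertex s) = 0 := fun s =>
      (T i).mul_transpose_injective ((hm s).trans (Matrix.zero_mul _).symm)
    funext r
    exact Subtype.ext (eq_zero_of_refVertex_eq_zero (c i r).2 fun s => congrFun (hv s) r)

theorem exists_stressForm (hΩ : IsOpen Ω) (hb : Bornology.IsBounded Ω) (hT : IsPartition Ω T)
    (hreg : interior (closure Ω) = Ω) {A : R3 → Mat →ₗ[ℝ] Mat} (hA : IsCompliance Ω T A) :
    ∃ a : stressSpace ΓD T hΩ hb →ₗ[ℝ] stressSpace ΓD T hΩ hb →ₗ[ℝ] ℝ,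
      (∀ c d, a c d = quad T A (stressField T c.1) (stressField T d.1)) ∧
      ∀ c, a c c = 0 → c = 0 := by
  obtain ⟨a, ha, ha0⟩ := exists_quadForm hT hreg hA
  exact ⟨a.compl₁₂ (stressSpace ΓD T hΩ hb).subtype (stressSpace ΓD T hΩ hb).subtype,
    fun c d => ha c.1 d.1, fun c hc => Subtype.ext (ha0 c.1 hc)⟩

/-! ### The constraint form -/

theorem integrable_dotProduct {u g : R3 → R3} (hu : ∀ r, IsL2 Ω fun x => u x r)
    (hg : ∀ r, IsL2 Ω fun x => g x r) :
    Integrable (fun x => u x ⬝ᵥ g x) (volume.restrict Ω) :=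
  integrable_finsetSum _ fun r _ => (hu r).integrable_mul (hg r)

theorem integrable_frob {w τ : R3 → Mat} (hw : ∀ r j, IsL2 Ω fun x => w x r j)
    (hτ : ∀ r j, IsL2 Ω fun x => τ x r j) :
    Integrable (fun x => frob (w x) (τ x)) (volume.restrict Ω) :=
  integrable_finsetSum _ fun r _ => integrable_finsetSum _ fun j _ =>
    (hw r j).integrable_mul (hτ r j)

theorem isL2_matDiv {τ : R3 → Mat} (hτ : IsStress Ω ΓD τ) (r : Fin 3) :
    IsL2 Ω fun x => matDiv Ω τ x r :=
  isL2_weakDiv (hτ r).1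

theorem matDiv_add (hΩ : IsOpen Ω) (hb : Bornology.IsBounded Ω) {σ τ : R3 → Mat}
    (hσ : IsStress Ω ΓD σ) (hτ : IsStress Ω ΓD τ) :
    matDiv Ω (σ + τ) =ᵐ[volume.restrict Ω] matDiv Ω σ + matDiv Ω τ := by
  filter_upwards [ae_all_iff.2 fun r => weakDiv_add hΩ hb (hσ r).1 (hτ r).1] with x hx
  exact funext hx

theorem matDiv_smul (hΩ : IsOpen Ω) (hb : Bornology.IsBounded Ω) (c : ℝ) {τ : R3 → Mat}
    (hτ : IsStress Ω ΓD τ) :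
    matDiv Ω (c • τ) =ᵐ[volume.restrict Ω] c • matDiv Ω τ := by
  filter_upwards [ae_all_iff.2 fun r => weakDiv_smul hΩ hb c (hτ r).1] with x hx
  exact funext hx

/-- The divergence is a chosen representative and is additive only almost everywhere, which suffices
under the integral. The square integrability needed to split the integrals comes from `stressSpace`.
-/
theorem exists_constraintForm (hΩ : IsOpen Ω) (hb : Bornology.IsBounded Ω)
    (hT : IsPartition Ω T) (hreg : interior (closure Ω) = Ω) :
    ∃ b : stressSpace ΓD T hΩ hb →ₗ[ℝ] ((ι → R3) × (ι → skew)) →ₗ[ℝ] ℝ, ∀ c n,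
      b c n = (∫ x in Ω, constField T n.1 x ⬝ᵥ matDiv Ω (stressField T c.1) x) +
        ∫ x in Ω, frob (constField T (fun i => (n.2 i).1) x) (stressField T c.1 x) := by
  have i1 : ∀ (c : stressSpace ΓD T hΩ hb) (v : ι → R3), Integrable
      (fun x => constField T v x ⬝ᵥ matDiv Ω (stressField T c.1) x) (volume.restrict Ω) :=
    fun c v => integrable_dotProduct (isL2_constField hT hreg v) (isL2_matDiv c.2)
  have i2 : ∀ (c : stressSpace ΓD T hΩ hb) (w : ι → Mat), Integrable
      (fun x => frob (constField T w x) (stressField T c.1 x)) (volume.restrict Ω) :=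
    fun c w => integrable_frob (isL2_constField_matrix hT hreg w) fun r => (c.2 r).1.1
  refine ⟨LinearMap.mk₂ ℝ (fun c n =>
    (∫ x in Ω, constField T n.1 x ⬝ᵥ matDiv Ω (stressField T c.1) x) +
      ∫ x in Ω, frob (constField T (fun i => (n.2 i).1) x) (stressField T c.1 x))
    ?_ ?_ ?_ ?_, fun _ _ => rfl⟩
  · intro c d n
    have h1 : ∫ x in Ω, constField T n.1 x ⬝ᵥ matDiv Ω (stressField T (c + d).1) x =
        (∫ x in Ω, constField T n.1 x ⬝ᵥ matDiv Ω (stressField T c.1) x) +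
          ∫ x in Ω, constField T n.1 x ⬝ᵥ matDiv Ω (stressField T d.1) x := by
      rw [← integral_add (i1 c _) (i1 d _)]
      refine integral_congr_ae ?_
      rw [Submodule.coe_add, map_add]
      filter_upwards [matDiv_add hΩ hb c.2 d.2] with x hx
      rw [hx, Pi.add_apply, dotProduct_add]
    have h2 : ∫ x in Ω, frob (constField T (fun i => (n.2 i).1) x) (stressField T (c + d).1 x) =
        (∫ x in Ω, frob (constField T (fun i => (n.2 i).1) x) (stressField T c.1 x)) +
          ∫ x in Ω, frob (constField T (fun i => (n.2 i).1) x) (stressField T d.1 x) := by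
      rw [← integral_add (i2 c _) (i2 d _), Submodule.coe_add, map_add]
      simp only [Pi.add_apply, frob_add_right]
    rw [h1, h2]
    ring
  · intro t c n
    have h1 : ∫ x in Ω, constField T n.1 x ⬝ᵥ matDiv Ω (stressField T (t • c).1) x =
        t * ∫ x in Ω, constField T n.1 x ⬝ᵥ matDiv Ω (stressField T c.1) x := by
      rw [← integral_const_mul]
      refine integral_congr_ae ?_
      rw [Submodule.coe_smul, map_smul]
      filter_upwards [matDiv_smul hΩ hb t c.2] with x hx
      rw [hx, Pi.smul_apply, dotProduct_smul, smul_eq_mul]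
    have h2 : ∫ x in Ω, frob (constField T (fun i => (n.2 i).1) x) (stressField T (t • c).1 x) =
        t * ∫ x in Ω, frob (constField T (fun i => (n.2 i).1) x) (stressField T c.1 x) := by
      rw [← integral_const_mul, Submodule.coe_smul, map_smul]
      simp only [Pi.smul_apply, frob_smul_right]
    rw [h1, h2, smul_eq_mul, mul_add]
  · intro c m n
    have hw : constField T (fun i => ((m + n).2 i).1) =
        constField T (fun i => (m.2 i).1) + constField T (fun i => (n.2 i).1) :=
      map_add (constField T) (fun i => (m.2 i).1) (fun i => (n.2 i).1)
    rw [Prod.fst_add, map_add, hw]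
    simp only [Pi.add_apply, add_dotProduct, frob_add_left]
    rw [integral_add (i1 c _) (i1 c _), integral_add (i2 c _) (i2 c _)]
    ring
  · intro t c n
    have hw : constField T (fun i => ((t • n).2 i).1) = t • constField T (fun i => (n.2 i).1) :=
      map_smul (constField T) t (fun i => (n.2 i).1)
    rw [Prod.smul_fst, map_smul, hw]
    simp only [Pi.smul_apply, smul_dotProduct, frob_smul_left, smul_eq_mul]
    rw [integral_const_mul, integral_const_mul, mul_add]

theorem exists_loadForm (hT : IsPartition Ω T) (hreg : interior (closure Ω) = Ω) {f : R3 → R3}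
    (hf : IsDisplacement Ω f) :
    ∃ F : ((ι → R3) × (ι → skew)) →ₗ[ℝ] ℝ, ∀ n,
      F n = ∫ x in Ω, f x ⬝ᵥ constField T n.1 x := by
  refine ⟨{ toFun := fun n => ∫ x in Ω, f x ⬝ᵥ constField T n.1 x
            map_add' := fun m n => ?_
            map_smul' := fun t n => ?_ }, fun _ => rfl⟩
  · rw [Prod.fst_add, map_add]
    simp only [Pi.add_apply, dotProduct_add]
    exact integral_add (integrable_dotProduct hf (isL2_constField hT hreg _))
      (integrable_dotProduct hf (isL2_constField hT hreg _))
  · rw [Prod.smul_fst, map_smul]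
    simp only [Pi.smul_apply, dotProduct_smul, smul_eq_mul, RingHom.id_apply]
    exact integral_const_mul _ _

/-- All terms of the method depend only on classes of fields modulo null sets, and every discrete
field is almost everywhere equal to one given by coordinates. The last two equations are merged into
one for pairs of test fields. -/
theorem isSolution_iff (hΩ : IsOpen Ω) (hb : Bornology.IsBounded Ω)
    (hT : IsPartition Ω T) (hreg : interior (closure Ω) = Ω)
    {A : R3 → Mat →ₗ[ℝ] Mat} {f : R3 → R3} {σ : R3 → Mat} {u : R3 → R3} {γ : R3 → Mat}
    {c : stressSpace ΓD T hΩ hb} {m : (ι → R3) × (ι → skew)}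
    (hσ : σ =ᵐ[volume.restrict Ω] stressField T c.1)
    (hu : u =ᵐ[volume.restrict Ω] constField T m.1)
    (hγ : γ =ᵐ[volume.restrict Ω] constField T fun i => (m.2 i).1)
    (hσd : IsDiscreteStress Ω ΓD T σ) (hud : IsDiscreteDisplacement Ω T u)
    (hγd : IsDiscreteRotation Ω T γ)
    {a : stressSpace ΓD T hΩ hb →ₗ[ℝ] stressSpace ΓD T hΩ hb →ₗ[ℝ] ℝ}
    (ha : ∀ c d, a c d = quad T A (stressField T c.1) (stressField T d.1))
    {b : stressSpace ΓD T hΩ hb →ₗ[ℝ] ((ι → R3) × (ι → skew)) →ₗ[ℝ] ℝ}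
    (hbf : ∀ c n, b c n = (∫ x in Ω, constField T n.1 x ⬝ᵥ matDiv Ω (stressField T c.1) x) +
        ∫ x in Ω, frob (constField T (fun i => (n.2 i).1) x) (stressField T c.1 x))
    {F : ((ι → R3) × (ι → skew)) →ₗ[ℝ] ℝ}
    (hF : ∀ n, F n = ∫ x in Ω, f x ⬝ᵥ constField T n.1 x) :
    IsSolution Ω ΓD T A f σ u γ ↔
      (∀ t : stressSpace ΓD T hΩ hb, a c t + b t m = 0) ∧ ∀ n, b c n = F n := by
  have e1 : ∀ τ : R3 → Mat, ∀ t : stressSpace ΓD T hΩ hb,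
      τ =ᵐ[volume.restrict Ω] stressField T t.1 →
      quad T A σ τ + (∫ x in Ω, u x ⬝ᵥ matDiv Ω τ x) + (∫ x in Ω, frob (γ x) (τ x)) =
        a c t + b t m := by
    intro τ t h
    rw [ha, hbf, quad_congr hT hreg A hσ h, matDiv_congr h, add_assoc]
    congr 2
    · exact integral_congr_ae (hu.mono fun x hx => by simp only [hx])
    · refine integral_congr_ae ?_
      filter_upwards [hγ, h] with x h1 h2
      simp only [h1, h2]
  have e2 : ∀ v : R3 → R3, ∀ n : ι → R3, v =ᵐ[volume.restrict Ω] constField T n →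
      (∫ x in Ω, matDiv Ω σ x ⬝ᵥ v x) =
        ∫ x in Ω, constField T n x ⬝ᵥ matDiv Ω (stressField T c.1) x := by
    intro v n h
    rw [matDiv_congr hσ]
    exact integral_congr_ae (h.mono fun x hx => by simp only [hx, dotProduct_comm])
  have e3 : ∀ v : R3 → R3, ∀ n : ι → R3, v =ᵐ[volume.restrict Ω] constField T n →
      (∫ x in Ω, f x ⬝ᵥ v x) = ∫ x in Ω, f x ⬝ᵥ constField T n x := by
    intro v n h
    exact integral_congr_ae (h.mono fun x hx => by simp only [hx])
  have e4 : ∀ w : R3 → Mat, ∀ n : ι → skew,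
      w =ᵐ[volume.restrict Ω] constField T (fun i => (n i).1) →
      (∫ x in Ω, frob (σ x) (w x)) =
        ∫ x in Ω, frob (constField T (fun i => (n i).1) x) (stressField T c.1 x) := by
    intro w n h
    refine integral_congr_ae ?_
    filter_upwards [hσ, h] with x h1 h2
    simp only [h1, h2, frob_comm]
  have z1 : constField T (0 : ι → R3) = 0 := map_zero _
  have z2 : constField T (fun i : ι => ((0 : ι → skew) i).1) = 0 := map_zero (constField T)
  -- The pairs (v, 0) and (0, w) recover the equilibrium equation and the weak symmetry separately;
  -- the load does not see w.
  have s1 : ∀ v : ι → R3, b c (v, 0) =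
      ∫ x in Ω, constField T v x ⬝ᵥ matDiv Ω (stressField T c.1) x := by
    intro v
    rw [hbf, z2]
    simp [frob]
  have s2 : ∀ w : ι → skew, b c (0, w) =
      ∫ x in Ω, frob (constField T (fun i => (w i).1) x) (stressField T c.1 x) := by
    intro w
    rw [hbf, z1]
    simp
  have s3 : ∀ (v : ι → R3) (w : ι → skew), F (v, w) = F (v, 0) := fun v w => by rw [hF, hF]
  have s4 : ∀ w : ι → skew, F (0, w) = 0 := fun w => by rw [s3]; exact map_zero F
  constructor
  · intro h
    refine ⟨fun t => ?_, fun n => ?_⟩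
    · rw [← e1 _ t (ae_eq_refl _)]
      exact h.constitutive _ (isDiscreteStress_stressField hT t.2)
    · have h1 := h.equilibrium _ (isDiscreteDisplacement_constField hT hreg n.1)
      rw [e2 _ n.1 (ae_eq_refl _), ← hF n] at h1
      have h2 := h.weak_symmetry _ (isDiscreteRotation_constField hT hreg n.2)
      rw [e4 _ n.2 (ae_eq_refl _)] at h2
      rw [hbf, h1, h2, add_zero]
  · rintro ⟨h1, h2⟩
    refine ⟨hσd, hud, hγd, fun τ hτ => ?_, fun v hv => ?_, fun w hw => ?_⟩
    · obtain ⟨t, hτt⟩ := hτ.exists_coord hΩ hb hT hreg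
      rw [e1 τ t hτt]
      exact h1 _
    · obtain ⟨n, hn⟩ := hv.exists_coord hT hreg
      rw [e2 v n hn, e3 v n hn, ← s1, h2, hF]
    · obtain ⟨n, hn⟩ := hw.exists_coord hT hreg
      rw [e4 w n hn, ← s2, h2, s4]

end Coordinates

end

end MSMFE

/-! ### Existence and uniqueness -/

theorem mainTheorem4 {ι : Type*} [Fintype ι] (Ω ΓD ΓN : Set MSMFE.R3) (T : ι → MSMFE.Element)
    (A : MSMFE.R3 → MSMFE.Mat →ₗ[ℝ] MSMFE.Mat) (f : MSMFE.R3 → MSMFE.R3)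
    (hΩ_open : IsOpen Ω) (hΩ_bounded : Bornology.IsBounded Ω)
    (hΩ_simply : IsSimplyConnected Ω) (hΩ_regular : interior (closure Ω) = Ω)
    (hT : MSMFE.IsPartition Ω T) (hΓ : MSMFE.IsBoundarySplit Ω T ΓD ΓN)
    (hA : MSMFE.IsCompliance Ω T A) (hf : MSMFE.IsDisplacement Ω f) :
    (∃ (σ : MSMFE.R3 → MSMFE.Mat) (u : MSMFE.R3 → MSMFE.R3) (γ : MSMFE.R3 → MSMFE.Mat),
      MSMFE.IsSolution Ω ΓD T A f σ u γ) ∧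
    ∀ (σ σ' : MSMFE.R3 → MSMFE.Mat) (u u' : MSMFE.R3 → MSMFE.R3)
      (γ γ' : MSMFE.R3 → MSMFE.Mat),
      MSMFE.IsSolution Ω ΓD T A f σ u γ → MSMFE.IsSolution Ω ΓD T A f σ' u' γ' →
      σ =ᵐ[volume.restrict Ω] σ' ∧ u =ᵐ[volume.restrict Ω] u' ∧
        γ =ᵐ[volume.restrict Ω] γ' := by
  have hconn : IsPreconnected Ω := hΩ_simply.isPathConnected.isConnected.isPreconnected
  obtain ⟨a, ha, ha'⟩ := MSMFE.exists_stressForm (ΓD := ΓD) hΩ_open hΩ_bounded hT hΩ_regular hA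
  obtain ⟨b, hb⟩ := MSMFE.exists_constraintForm (ΓD := ΓD) hΩ_open hΩ_bounded hT hΩ_regular
  obtain ⟨F, hF⟩ := MSMFE.exists_loadForm hT hΩ_regular hf
  -- The orthogonality to coordinate stresses is transferred to all discrete stresses, to which the
  -- injectivity result applies.
  have hb' : ∀ m, (∀ s, b s m = 0) → m = 0 := by
    intro m hm
    have h := MSMFE.eq_zero_of_pairing_eq_zero hΩ_open hΩ_bounded hconn hT hΩ_regular hΓ
      (u := m.1) (γ := fun i => (m.2 i).1) (fun i => (m.2 i).2) fun τ hτ => by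
        obtain ⟨t, ht⟩ := hτ.exists_coord hΩ_open hΩ_bounded hT hΩ_regular
        rw [MSMFE.matDiv_congr ht, ← hm t, hb]
        congr 1
        exact integral_congr_ae (ht.mono fun x hx => by simp only [hx]; rfl)
    exact Prod.ext h.1 (funext fun i => Subtype.ext (congrFun h.2 i))
  constructor
  · obtain ⟨c, m, h⟩ := MSMFE.exists_saddle
      (S := MSMFE.stressSpace ΓD T hΩ_open hΩ_bounded) ha' hb' F
    exact ⟨_, _, _, (MSMFE.isSolution_iff hΩ_open hΩ_bounded hT hΩ_regular (ae_eq_refl _)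
      (ae_eq_refl _) (ae_eq_refl _) (MSMFE.isDiscreteStress_stressField hT c.2)
      (MSMFE.isDiscreteDisplacement_constField hT hΩ_regular m.1)
      (MSMFE.isDiscreteRotation_constField hT hΩ_regular m.2) ha hb hF).2 h⟩
  · intro σ σ' u u' γ γ' h h'
    obtain ⟨c, hc⟩ := h.stress_mem.exists_coord hΩ_open hΩ_bounded hT hΩ_regular
    obtain ⟨v, hv⟩ := h.displacement_mem.exists_coord hT hΩ_regular
    obtain ⟨w, hw⟩ := h.rotation_mem.exists_coord hT hΩ_regular
    obtain ⟨c', hc'⟩ := h'.stress_mem.exists_coord hΩ_open hΩ_bounded hT hΩ_regular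
    obtain ⟨v', hv'⟩ := h'.displacement_mem.exists_coord hT hΩ_regular
    obtain ⟨w', hw'⟩ := h'.rotation_mem.exists_coord hT hΩ_regular
    have e := (MSMFE.isSolution_iff hΩ_open hΩ_bounded hT hΩ_regular (m := (v, w))
      hc hv hw h.stress_mem h.displacement_mem h.rotation_mem ha hb hF).1 h
    have e' := (MSMFE.isSolution_iff hΩ_open hΩ_bounded hT hΩ_regular (m := (v', w'))
      hc' hv' hw' h'.stress_mem h'.displacement_mem h'.rotation_mem ha hb hF).1 h'
    obtain ⟨rfl, hm⟩ := MSMFE.saddle_unique (S := MSMFE.stressSpace ΓD T hΩ_open hΩ_bounded)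
      ha' hb' e e'
    obtain ⟨rfl, rfl⟩ := Prod.ext_iff.1 hm
    exact ⟨hc.trans hc'.symm, hv.trans hv'.symm, hw.trans hw'.symm⟩
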